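/- **Theorem 3.9.** Let $\Omega\subset\mathbb R^N$ be open and bounded, $T>0$, $\Omega_T:=\Omega\times(0,T)$, and $\mathbf p=(p_1,\dots,p_N)$ with $p_j\in(1,\infty)$. *Function spaces.* Let $W^{1,\mathbf p}(\Omega)=\{w\in W^{1,1}(\Omega): \partial_j w\in L^{p_j}(\Omega),\ 1\le j\le N\}$, and let $\overline W^{1,\mathbf p}_{\rm o}(\Omega)$ be the closure of $C^\infty_{\rm o}(\Omega)$ (smooth functions with compact support in $\Omega$) in $W^{1,\mathbf p}(\Omega)$ with respect to the norm $\|w\|_{L^1(\Omega)}+\sum_j\|\partial_j w\|_{L^{p_j}(\Omega)}$. Functions of time with values in function spaces on $\Omega$ are identified with functions on $\Omega_T$. Let $L^{\mathbf p}(0,T;W^{1,\mathbf p}(\Omega))=\{w\in L^1(0,T;W^{1,1}(\Omega)):\partial_j w\in L^{p_j}(\Omega_T),\ 1\le j\le N\}$, and let $L^{\mathbf p}(0,T;\overline W^{1,\mathbf p}_{\rm o}(\Omega))$ be the space of measurable $w:(0,T)\to\overline W^{1,\mathbf p}_{\rm o}(\Omega)$ with $w\in L^1(\Omega_T)$ and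 $\partial_j w\in L^{p_j}(\Omega_T)$ for all $j$. *Vector field.* Let $A=A(x,t,u,\xi):\Omega_T\times\mathbb R\times\mathbb R^N\to\mathbb R^N$ be a Carathéodory vector field (measurable in $(x,t)$ for all $(u,\xi)$, continuous in $(u,\xi)$ for a.e. $(x,t)$). Suppose there are constants $\Lambda,L>0$ and non-negative functions $a,b,c\in L^1(\Omega_T)$ such that for a.e. $(x,t)\in\Omega_T$, all $u,v\in\mathbb R$, all $\xi,\eta\in\mathbb R^N$ and all $j$: $$|A_j(x,t,u,\xi)|\le\Lambda\Big(\sum_{k=1}^N|\xi_k|^{p_k}+a(x,t)\Big)^{\frac{p_j-1}{p_j}},$$ $$A(x,t,u,\xi)\cdot\xi\ge\Lambda^{-1}\sum_{k=1}^N|\xi_k|^{p_k}-b(x,t),$$ $$\big(A(x,t,u,\xi)-A(x,t,u,\eta)\big)\cdot(\xi-\eta)\ge0,$$ $$|A_j(x,t,u,\xi)-A_j(x,t,v,\xi)|\le L|u-v|\Big(c(x,t)+\sum_{k=1}^N|\xi_k|^{p_k}\Big)^{\frac{p_j-1}{p_j}}.$$ *Solutions.* For $f\in L^2(\Omega_T)$,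 $g\in L^{\mathbf p}(0,T;W^{1,\mathbf p}(\Omega))$ and $u_0\in L^2(\Omega)$, a solution of the Cauchy–Dirichlet problem for $\partial_t u-\nabla\cdot A(x,t,u,\nabla u)=f$ with source $f$, boundary data $g$ and initial data $u_0$ is a function $u\in L^{\mathbf p}(0,T;W^{1,\mathbf p}(\Omega))\cap C([0,T];L^2(\Omega))$ such that 1. $\displaystyle\iint_{\Omega_T}A(x,t,u,\nabla u)\cdot\nabla\varphi\,dx\,dt-\iint_{\Omega_T}u\,\partial_t\varphi\,dx\,dt=\iint_{\Omega_T}f\varphi\,dx\,dt$ for all $\varphi\in C^\infty_{\rm o}(\Omega_T)$; 2. $u(t)\to u_0$ in $L^2(\Omega)$ as $t\to0$; 3. $u-g\in L^{\mathbf p}(0,T;\overline W^{1,\mathbf p}_{\rm o}(\Omega))$. *Claim.* Let $u$ be a solution with source $f_u\in L^2(\Omega_T)$, boundary data $g_u\in L^{\mathbf p}(0,T;W^{1,\mathbf p}(\Omega))$ and initial data $u_0\in L^2(\Omega)$, and let $v$ be a solution (for the same $A$) with source $f_v\in L^2(\Omega_T)$, boundary data $g_v\in L^{\mathbf p}(0,T;W^{1,\mathbf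 p}(\Omega))$ and initial data $v_0\in L^2(\Omega)$. If $v_0\le u_0$ a.e. in $\Omega$, and $f_v\le f_u$ and $g_v\le g_u$ a.e. in $\Omega_T$, then $v\le u$ a.e. in $\Omega_T$. -/

import Mathlib

open MeasureTheory Filter Topology
open scoped ContDiff ENNReal

namespace Aniso

/-- Euclidean space `ℝ^N`. -/
abbrev E (N : ℕ) := EuclideanSpace ℝ (Fin N)

/-- The space-time cylinder `Ω_T = Ω × (0, T)`; points are written `z = (x, t)`. -/
def cyl {N : ℕ} (Ω : Set (E N)) (T : ℝ) : Set (E N × ℝ) := Ω ×ˢ Set.Ioo 0 T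

/-- `φ ∈ C_o^∞(U)`: smooth with compact support contained in `U`. -/
structure IsTest {F : Type*} [NormedAddCommGroup F] [NormedSpace ℝ F]
    (U : Set F) (φ : F → ℝ) : Prop where
  smooth : ContDiff ℝ ∞ φ
  compact : HasCompactSupport φ
  support : tsupport φ ⊆ U

/-- The classical partial derivative `∂_j φ` of a function on `ℝ^N`. -/
noncomputable def pd {N : ℕ} (j : Fin N) (φ : E N → ℝ) (x : E N) : ℝ :=
  fderiv ℝ φ x (EuclideanSpace.single j 1)

/-- The classical spatial partial derivative `∂_j φ` of a function on `ℝ^N × ℝ`. -/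
noncomputable def pdx {N : ℕ} (j : Fin N) (φ : E N × ℝ → ℝ) (z : E N × ℝ) : ℝ :=
  fderiv ℝ φ z (EuclideanSpace.single j 1, 0)

/-- The classical time derivative `∂_t φ` of a function on `ℝ^N × ℝ`. -/
noncomputable def pdt {N : ℕ} (φ : E N × ℝ → ℝ) (z : E N × ℝ) : ℝ :=
  fderiv ℝ φ z (0, 1)

/-- `v ∈ W^{1,1}(Ω)` with weak gradient `D`. -/
structure IsW11 {N : ℕ} (Ω : Set (E N)) (v : E N → ℝ) (D : E N → E N) : Prop where
  integrable : Integrable v (volume.restrict Ω)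
  integrable_grad : ∀ j, Integrable (fun x => D x j) (volume.restrict Ω)
  weak : ∀ j φ, IsTest Ω φ → ∫ x in Ω, v x * pd j φ x = - ∫ x in Ω, D x j * φ x

/-- `v ∈ W^{1,𝐩}(Ω)` with weak gradient `D`: `v ∈ W^{1,1}(Ω)` and `∂_j v ∈ L^{p_j}(Ω)`. -/
structure IsW1p {N : ℕ} (Ω : Set (E N)) (p : Fin N → ℝ) (v : E N → ℝ) (D : E N → E N) :
    Prop extends IsW11 Ω v D where
  memLp_grad : ∀ j, MemLp (fun x => D x j) (ENNReal.ofReal (p j)) (volume.restrict Ω)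

/-- `v`, with weak gradient `D`, lies in the closure of `C_o^∞(Ω)` in `W^{1,𝐩}(Ω)` with respect to
the norm `‖v‖_{L^1(Ω)} + ∑_j ‖∂_j v‖_{L^{p_j}(Ω)}`. -/
structure IsW1p0 {N : ℕ} (Ω : Set (E N)) (p : Fin N → ℝ) (v : E N → ℝ) (D : E N → E N) :
    Prop extends IsW1p Ω p v D where
  closure : ∀ ε : ℝ, 0 < ε → ∃ φ, IsTest Ω φ ∧
    eLpNorm (fun x => v x - φ x) 1 (volume.restrict Ω)
      + ∑ j, eLpNorm (fun x => D x j - pd j φ x) (ENNReal.ofReal (p j)) (volume.restrict Ω)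
        < ENNReal.ofReal ε

/-- `v ∈ L^𝐩(0,T; W^{1,𝐩}(Ω))` with spatial weak gradient `D`, that is, `v ∈ L^1(0,T; W^{1,1}(Ω))`
and `∂_j v ∈ L^{p_j}(Ω_T)`. As usual, a function of time with values in a space of functions on `Ω`
is identified with a function on `Ω_T`; since the spaces in question are separable, strong
measurability in time is measurability on `Ω_T`, which is part of `Integrable` and `MemLp`. -/
structure IsLpW {N : ℕ} (Ω : Set (E N)) (T : ℝ) (p : Fin N → ℝ)
    (v : E N × ℝ → ℝ) (D : E N × ℝ → E N) : Prop where
  integrable : Integrable v (volume.restrict (cyl Ω T))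
  integrable_grad : ∀ j, Integrable (fun z => D z j) (volume.restrict (cyl Ω T))
  slice : ∀ᵐ t ∂(volume.restrict (Set.Ioo 0 T)),
    IsW11 Ω (fun x => v (x, t)) (fun x => D (x, t))
  memLp_grad : ∀ j, MemLp (fun z => D z j) (ENNReal.ofReal (p j)) (volume.restrict (cyl Ω T))

/-- `v ∈ L^𝐩(0,T; W^{1,𝐩}(Ω))`. -/
def MemLpW {N : ℕ} (Ω : Set (E N)) (T : ℝ) (p : Fin N → ℝ) (v : E N × ℝ → ℝ) : Prop :=
  ∃ D, IsLpW Ω T p v D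

/-- `w ∈ L^𝐩(0,T; W_o^{1,𝐩}(Ω))`, where `W_o^{1,𝐩}(Ω)` is the closure of `C_o^∞(Ω)`: the slices
`w(·,t)` lie in `W_o^{1,𝐩}(Ω)`, `w ∈ L^1(0,T; L^1(Ω))` and `∂_j w ∈ L^{p_j}(0,T; L^{p_j}(Ω))`. -/
def MemLpW0 {N : ℕ} (Ω : Set (E N)) (T : ℝ) (p : Fin N → ℝ) (w : E N × ℝ → ℝ) : Prop :=
  ∃ D : E N × ℝ → E N,
    Integrable w (volume.restrict (cyl Ω T)) ∧
    (∀ j, MemLp (fun z => D z j) (ENNReal.ofReal (p j)) (volume.restrict (cyl Ω T))) ∧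
    ∀ᵐ t ∂(volume.restrict (Set.Ioo 0 T)),
      IsW1p0 Ω p (fun x => w (x, t)) (fun x => D (x, t))

/-- `A(x,t,u,ξ)` is a Carathéodory vector field on `Ω_T × ℝ × ℝ^N`: measurable in `(x,t)` for all
`(u,ξ)`, and continuous in `(u,ξ)` for almost every `(x,t)`. -/
structure IsCaratheodory {N : ℕ} (Ω : Set (E N)) (T : ℝ) (A : E N → ℝ → ℝ → E N → E N) :
    Prop where
  measurable : ∀ (s : ℝ) (ξ : E N),
    AEMeasurable (fun z : E N × ℝ => A z.1 z.2 s ξ) (volume.restrict (cyl Ω T))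
  continuous : ∀ᵐ z ∂(volume.restrict (cyl Ω T)),
    Continuous (fun q : ℝ × E N => A z.1 z.2 q.1 q.2)

/-- Growth: `|A_j(x,t,u,ξ)| ≤ Λ (∑_k |ξ_k|^{p_k} + a(x,t))^{(p_j - 1)/p_j}`. -/
def Growth {N : ℕ} (Ω : Set (E N)) (T : ℝ) (p : Fin N → ℝ) (A : E N → ℝ → ℝ → E N → E N)
    (Λ : ℝ) (a : E N × ℝ → ℝ) : Prop :=
  ∀ᵐ z ∂(volume.restrict (cyl Ω T)), ∀ (s : ℝ) (ξ : E N) (j : Fin N),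
    |A z.1 z.2 s ξ j| ≤ Λ * (∑ k, |ξ k| ^ p k + a z) ^ ((p j - 1) / p j)

/-- Coercivity: `A(x,t,u,ξ) · ξ ≥ Λ⁻¹ ∑_j |ξ_j|^{p_j} - b(x,t)`. -/
def Coercive {N : ℕ} (Ω : Set (E N)) (T : ℝ) (p : Fin N → ℝ) (A : E N → ℝ → ℝ → E N → E N)
    (Λ : ℝ) (b : E N × ℝ → ℝ) : Prop :=
  ∀ᵐ z ∂(volume.restrict (cyl Ω T)), ∀ (s : ℝ) (ξ : E N),
    Λ⁻¹ * ∑ j, |ξ j| ^ p j - b z ≤ ∑ j, A z.1 z.2 s ξ j * ξ j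

/-- Weak monotonicity: `(A(x,t,u,ξ) - A(x,t,u,η)) · (ξ - η) ≥ 0`. -/
def MonotoneGrad {N : ℕ} (Ω : Set (E N)) (T : ℝ) (A : E N → ℝ → ℝ → E N → E N) : Prop :=
  ∀ᵐ z ∂(volume.restrict (cyl Ω T)), ∀ (s : ℝ) (ξ η : E N),
    0 ≤ ∑ j, (A z.1 z.2 s ξ j - A z.1 z.2 s η j) * (ξ j - η j)

/-- Lipschitz continuity in `u`:
`|A_j(x,t,u,ξ) - A_j(x,t,v,ξ)| ≤ L |u - v| (c(x,t) + ∑_k |ξ_k|^{p_k})^{(p_j - 1)/p_j}`. -/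
def LipschitzInU {N : ℕ} (Ω : Set (E N)) (T : ℝ) (p : Fin N → ℝ)
    (A : E N → ℝ → ℝ → E N → E N) (L : ℝ) (c : E N × ℝ → ℝ) : Prop :=
  ∀ᵐ z ∂(volume.restrict (cyl Ω T)), ∀ (s r : ℝ) (ξ : E N) (j : Fin N),
    |A z.1 z.2 s ξ j - A z.1 z.2 r ξ j|
      ≤ L * |s - r| * (c z + ∑ k, |ξ k| ^ p k) ^ ((p j - 1) / p j)

/-- `u ∈ L^𝐩(0,T; W^{1,𝐩}(Ω)) ∩ L^2(Ω_T)` is a weak solution of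
`∂_t u - ∇·A(x,t,u,∇u) = f` in `Ω_T`. -/
def IsWeakSolution {N : ℕ} (Ω : Set (E N)) (T : ℝ) (p : Fin N → ℝ)
    (A : E N → ℝ → ℝ → E N → E N) (f : E N × ℝ → ℝ) (u : E N × ℝ → ℝ) : Prop :=
  MemLp u 2 (volume.restrict (cyl Ω T)) ∧
  ∃ Du : E N × ℝ → E N, IsLpW Ω T p u Du ∧
    ∀ φ, IsTest (cyl Ω T) φ →
      (∫ z in cyl Ω T, ∑ j, A z.1 z.2 (u z) (Du z) j * pdx j φ z)
        - (∫ z in cyl Ω T, u z * pdt φ z)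
      = ∫ z in cyl Ω T, f z * φ z

/-- `u ∈ C([0,T]; L^2(Ω))`, and `u(t) → u₀` in `L^2(Ω)` as `t → 0`. -/
def IsContL2 {N : ℕ} (Ω : Set (E N)) (T : ℝ) (u₀ : E N → ℝ) (u : E N × ℝ → ℝ) : Prop :=
  ∃ U : ℝ → Lp ℝ 2 (volume.restrict Ω),
    ContinuousOn U (Set.Icc 0 T) ∧
    (∀ᵐ t ∂(volume.restrict (Set.Ioo 0 T)),
      ∀ᵐ x ∂(volume.restrict Ω), U t x = u (x, t)) ∧
    Tendsto (fun t => eLpNorm (fun x => U t x - u₀ x) 2 (volume.restrict Ω)) (𝓝[>] 0) (𝓝 0)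

/-- `u` is a solution of the Cauchy–Dirichlet problem for `∂_t u - ∇·A(x,t,u,∇u) = f` in `Ω_T`
with lateral boundary values `g` and initial values `u₀`. -/
structure IsCDSolution {N : ℕ} (Ω : Set (E N)) (T : ℝ) (p : Fin N → ℝ)
    (A : E N → ℝ → ℝ → E N → E N) (f g : E N × ℝ → ℝ) (u₀ : E N → ℝ) (u : E N × ℝ → ℝ) :
    Prop where
  weakSolution : IsWeakSolution Ω T p A f u
  initial : IsContL2 Ω T u₀ u
  boundary : MemLpW0 Ω T p (fun z => u z - g z)

end Aniso

/-! Put w = v - u and let H_n be smooth, nondecreasing, 0 on (-∞, 0] and 1 on [1/(n+1), ∞).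
Formally, testing the difference of the two equations with H_n(w) gives, with G_n the primitive of
H_n, that the increment of ∫ G_n(w) is at most -∬ (A(v,∇v) - A(u,∇u)) · ∇w H_n'(w), since (f_v -
f_u) H_n(w) ≤ 0. Inserting A(v,∇u) splits the flux: monotonicity gives one part a sign, and the
Lipschitz condition bounds the other by L |w| H_n'(w) times a fixed integrable function. As |w|
H_n'(w) is bounded uniformly in n and tends to 0 pointwise, this error vanishes (`neg_sum_flux_le`,
`abs_mul_deriv_step_le`, `tendsto_abs_mul_deriv_step`). Since G_n(w) increases to the positive part
of w and w ≤ 0 initially, w ≤ 0 at all times (`ae_nonpos_of_energy`).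

Two points make the formal test rigorous. In space, H_n(w) must be a limit of test functions
although w itself need not vanish on the boundary. On almost every time slice w ≤ η with η in the
closure of test functions. If φ is a test function near η, then φ minus a mollification of the
nonnegative function η - w is nonpositive off the support of φ, so H_n of it is a test function
(`exists_test_below`, `exists_test_approx`).

In time, w has no derivative in L². The equation is integrated over (τ, τ+h] against a function of x
alone (`integral_time_increment`), that function is taken to be H_n(w(τ+h)), and convexity of G_n
turns the left side into an increment of ∫ G_n(w) (`integral_primitive_sub_le`). Dividing by h,
integrating in τ and letting h → 0 gives the energy inequality `energy_le`: the flux enters as a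
Steklov average and the test function as a time translate, and both converge in conjugate Lebesgue
spaces. -/

set_option linter.unusedSectionVars false

namespace Aniso

/-! ### Convergence of products in conjugate L^p spaces, and slices of product spaces. -/

section LpTools

variable {α β : Type*} [MeasurableSpace α] [MeasurableSpace β] {μ : Measure α} {ν : Measure β}

/-- Hölder applied to f_i g_i - f₀ g₀ = (f_i - f₀) g_i + f₀ (g_i - g₀). The filter is arbitrary
because it serves both for sequences of test functions and for h → 0⁺. -/
theorem tendsto_integral_mul_of_tendsto_eLpNorm {ι : Type*} {l : Filter ι} {p q : ℝ≥0∞}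
    [hpq : ENNReal.HolderTriple p q 1] {f : ι → α → ℝ} {g : ι → α → ℝ} {f₀ g₀ : α → ℝ}
    (hq : 1 ≤ q)
    (hf : ∀ᶠ i in l, MemLp (f i) p μ) (hf₀ : MemLp f₀ p μ)
    (hg : ∀ᶠ i in l, MemLp (g i) q μ) (hg₀ : MemLp g₀ q μ)
    (hfl : Tendsto (fun i => eLpNorm (fun x => f i x - f₀ x) p μ) l (𝓝 0))
    (hgl : Tendsto (fun i => eLpNorm (fun x => g i x - g₀ x) q μ) l (𝓝 0)) :
    Tendsto (fun i => ∫ x, f i x * g i x ∂μ) l (𝓝 (∫ x, f₀ x * g₀ x ∂μ)) := by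
  have hint : ∀ {F G : α → ℝ}, MemLp F p μ → MemLp G q μ → Integrable (fun x => F x * G x) μ :=
    fun hF hG => memLp_one_iff_integrable.1 (hG.mul' hF)
  refine tendsto_integral_of_L1' _ (hint hf₀ hg₀).1 ?_ ?_
  · filter_upwards [hf, hg] with i h1 h2 using hint h1 h2
  have hb : ∀ᶠ i in l, eLpNorm ((fun x => f i x * g i x) - fun x => f₀ x * g₀ x) 1 μ ≤
      eLpNorm (fun x => f i x - f₀ x) p μ * (eLpNorm (fun x => g i x - g₀ x) q μ + eLpNorm g₀ q μ)
        + eLpNorm f₀ p μ * eLpNorm (fun x => g i x - g₀ x) q μ := by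
    filter_upwards [hf, hg] with i h1 h2
    have e : ((fun x => f i x * g i x) - fun x => f₀ x * g₀ x) =
        ((fun x => f i x - f₀ x) • g i) + (f₀ • fun x => g i x - g₀ x) := by
      ext x; simp; ring
    have hg' : eLpNorm (g i) q μ ≤ eLpNorm (fun x => g i x - g₀ x) q μ + eLpNorm g₀ q μ := by
      have e' : g i = (fun x => g i x - g₀ x) + g₀ := by ext x; simp
      conv_lhs => rw [e']
      exact eLpNorm_add_le (h2.sub hg₀).1 hg₀.1 hq
    rw [e]
    refine (eLpNorm_add_le ((h1.sub hf₀).1.smul h2.1) (hf₀.1.smul (h2.sub hg₀).1) le_rfl).trans ?_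
    refine add_le_add ((eLpNorm_smul_le_mul_eLpNorm (p := p) (q := q) h2.1
      (h1.sub hf₀).1).trans ?_) (eLpNorm_smul_le_mul_eLpNorm (p := p) (q := q) (h2.sub hg₀).1 hf₀.1)
    gcongr
    exact le_rfl
  refine tendsto_of_tendsto_of_tendsto_of_le_of_le' tendsto_const_nhds ?_
    (Eventually.of_forall fun _ => zero_le) hb
  have h1 : Tendsto (fun i => eLpNorm (fun x => g i x - g₀ x) q μ + eLpNorm g₀ q μ) l
      (𝓝 (0 + eLpNorm g₀ q μ)) := hgl.add tendsto_const_nhds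
  have h2 := ENNReal.Tendsto.mul hfl (Or.inr (by simpa using hg₀.2.ne)) h1 (Or.inr (by simp))
  have h3 := ENNReal.Tendsto.const_mul (a := eLpNorm f₀ p μ) hgl (Or.inr hf₀.2.ne)
  simpa using h2.add h3

theorem tendsto_eLpNorm_zero_of_dominated {p : ℝ≥0∞} (hp : 1 ≤ p) (hp' : p ≠ ⊤)
    {f : ℕ → α → ℝ} {g : α → ℝ} (hg : MemLp g p μ) (hf : ∀ n, AEStronglyMeasurable (f n) μ)
    (hb : ∀ n, ∀ᵐ x ∂μ, |f n x| ≤ |g x|)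
    (hl : ∀ᵐ x ∂μ, Tendsto (fun n => f n x) atTop (𝓝 0)) :
    Tendsto (fun n => eLpNorm (f n) p μ) atTop (𝓝 0) := by
  have hp0 : p ≠ 0 := (zero_lt_one.trans_le hp).ne'
  have hpr : 0 < p.toReal := ENNReal.toReal_pos hp0 hp'
  simp_rw [eLpNorm_eq_lintegral_rpow_enorm_toReal hp0 hp']
  have key : Tendsto (fun n => ∫⁻ x, ‖f n x‖ₑ ^ p.toReal ∂μ) atTop (𝓝 (∫⁻ _, 0 ∂μ)) := by
    refine tendsto_lintegral_of_dominated_convergence' (fun x => ‖g x‖ₑ ^ p.toReal)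
      (fun n => (hf n).enorm.pow_const _) (fun n => ?_) ?_ ?_
    · filter_upwards [hb n] with x hx
      refine ENNReal.rpow_le_rpow ?_ hpr.le
      rwa [enorm_le_iff_norm_le]
    · exact ((eLpNorm_lt_top_iff_lintegral_rpow_enorm_lt_top hp0 hp').1 hg.2).ne
    · filter_upwards [hl] with x hx
      have h1 : Tendsto (fun n => ‖f n x‖ₑ) atTop (𝓝 0) := by
        simpa using hx.enorm
      simpa [ENNReal.zero_rpow_of_pos hpr] using h1.ennrpow_const p.toReal
  have := key.ennrpow_const (1 / p.toReal)
  simpa [hpr] using this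

theorem MemLp.ae_prodMk_left {p : ℝ≥0∞} (hp0 : p ≠ 0) (hp' : p ≠ ⊤) [SFinite ν] [SFinite μ]
    {f : α × β → ℝ} (hf : MemLp f p (μ.prod ν)) :
    ∀ᵐ x ∂μ, MemLp (fun y => f (x, y)) p ν := by
  have h1 := hf.1.prodMk_left
  have h2 := (eLpNorm_lt_top_iff_lintegral_rpow_enorm_lt_top hp0 hp').1 hf.2
  have hm : AEMeasurable (fun z => ‖f z‖ₑ ^ p.toReal) (μ.prod ν) := hf.1.enorm.pow_const _
  rw [lintegral_prod _ hm] at h2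
  filter_upwards [h1, ae_lt_top' hm.lintegral_prod_right' h2.ne] with x hx1 hx2
  exact ⟨hx1, (eLpNorm_lt_top_iff_lintegral_rpow_enorm_lt_top hp0 hp').2 hx2⟩

theorem MemLp.ae_prodMk_right {p : ℝ≥0∞} (hp0 : p ≠ 0) (hp' : p ≠ ⊤) [SFinite ν] [SFinite μ]
    {f : α × β → ℝ} (hf : MemLp f p (μ.prod ν)) :
    ∀ᵐ y ∂ν, MemLp (fun x => f (x, y)) p μ := by
  have : MemLp (f ∘ Prod.swap) p (ν.prod μ) :=
    hf.comp_measurePreserving Measure.measurePreserving_swap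
  exact MemLp.ae_prodMk_left hp0 hp' this

/-- The first marginal of the product is the total mass of ν times μ. This transfers convergence of
functions of x alone to space-time slabs. -/
theorem eLpNorm_comp_fst {p : ℝ≥0∞} (hp' : p ≠ ⊤) [IsFiniteMeasure ν]
    {f : α → ℝ} (hf : AEStronglyMeasurable f μ) :
    eLpNorm (fun z : α × β => f z.1) p (μ.prod ν) =
      (ν Set.univ) ^ (1 / p.toReal) * eLpNorm f p μ := by
  have hm : (μ.prod ν).map Prod.fst = ν Set.univ • μ := by simp
  have h := eLpNorm_map_measure (μ := μ.prod ν) (f := Prod.fst) (g := f) (p := p)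
    (by rw [hm]; exact hf.smul_measure _) measurable_fst.aemeasurable
  rw [hm, eLpNorm_smul_measure_of_ne_top hp'] at h
  rw [← Function.comp_def f, ← h]
  simp

end LpTools

/-! ### Averages of translates: a common frame for mollification in space and Steklov means in time.
-/

section Translation

variable {F : Type*} [NormedAddCommGroup F] [MeasurableSpace F] [BorelSpace F]
  [SecondCountableTopology F] {μ : Measure F} [μ.InnerRegularCompactLTTop]
  [IsLocallyFiniteMeasure μ] [μ.IsAddRightInvariant] [SFinite μ] {p : ℝ≥0∞}

/-- Translations are measure preserving and depend continuously on y in the compact-open topology,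
so they act continuously on L^p. -/
theorem tendsto_eLpNorm_translate_sub (hp : 1 ≤ p) (hp' : p ≠ ⊤) {g : F → ℝ} (hg : MemLp g p μ) :
    Tendsto (fun y => eLpNorm (fun x => g (x + y) - g x) p μ) (𝓝 0) (𝓝 0) := by
  have : Fact (1 ≤ p) := ⟨hp⟩
  let T : F → C(F, F) := fun y => ⟨fun x => x + y, by fun_prop⟩
  have hT : Continuous T := by
    refine ContinuousMap.continuous_of_continuous_uncurry _ ?_
    change Continuous fun z : F × F => z.2 + z.1
    fun_prop
  have hm : ∀ y, MeasurePreserving (T y) μ μ := fun y => measurePreserving_add_right μ y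
  have h := (Continuous.compMeasurePreservingLp (continuous_const (y := hg.toLp g)) hT hm hp').tendsto 0
  rw [tendsto_iff_edist_tendsto_0] at h
  refine h.congr fun y => ?_
  rw [Lp.edist_def]
  refine eLpNorm_congr_ae ?_
  have h1 := Lp.coeFn_compMeasurePreserving (hg.toLp g) (hm y)
  have h2 := Lp.coeFn_compMeasurePreserving (hg.toLp g) (hm 0)
  have h3 := (hm y).quasiMeasurePreserving.ae_eq_comp hg.coeFn_toLp
  have h4 := (hm 0).quasiMeasurePreserving.ae_eq_comp hg.coeFn_toLp
  filter_upwards [h1, h2, h3, h4] with x e1 e2 e3 e4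
  simp only [Pi.sub_apply]
  rw [e1, e2, e3, e4]
  simp [T]

variable {ν : Measure F} [IsProbabilityMeasure ν]

/-- The shear (y, x) ↦ (y, x + y) preserves ν × μ because each translation preserves μ. -/
theorem memLp_translate_prod {g : F → ℝ} (hg : MemLp g p μ) :
    MemLp (fun z : F × F => g (z.2 + z.1)) p (ν.prod μ) := by
  have hm : MeasurePreserving (fun z : F × F => (z.1, z.2 + z.1)) (ν.prod μ) (ν.prod μ) :=
    (MeasurePreserving.id ν).skew_product (g := fun y x => x + y) (by fun_prop)
      (Eventually.of_forall fun y => (measurePreserving_add_right μ y).map_eq)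
  exact (hg.comp_snd ν).comp_measurePreserving hm

/-- The average `x ↦ ∫ g(x + y) dν(y)`. -/
noncomputable def avg (ν : Measure F) (g : F → ℝ) (x : F) : ℝ := ∫ y, g (x + y) ∂ν

theorem aestronglyMeasurable_avg {g : F → ℝ} (hg : MemLp g p μ) :
    AEStronglyMeasurable (avg ν g) μ := by
  have := (memLp_translate_prod (ν := ν) hg).1.prod_swap
  exact this.integral_prod_right'

/-- Minkowski's integral inequality: for fixed x, ν being a probability measure, the mean of g(x +
y) - g(x) is at most its L^p(ν) norm; Tonelli then exchanges the two integrations. -/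
theorem eLpNorm_avg_sub_le (hp : 1 ≤ p) (hp' : p ≠ ⊤) {g : F → ℝ} (hg : MemLp g p μ)
    {δ : ℝ≥0∞} (hδ : ∀ᵐ y ∂ν, eLpNorm (fun x => g (x + y) - g x) p μ ≤ δ) :
    eLpNorm (fun x => avg ν g x - g x) p μ ≤ δ := by
  have hp0 : p ≠ 0 := (zero_lt_one.trans_le hp).ne'
  have hpr : 0 < p.toReal := ENNReal.toReal_pos hp0 hp'
  have h1 : MemLp (fun z : F × F => g (z.2 + z.1) - g z.2) p (ν.prod μ) :=
    (memLp_translate_prod hg).sub (hg.comp_snd ν)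
  have h2 := MemLp.ae_prodMk_right hp0 hp' (memLp_translate_prod (ν := ν) hg)
  have key : ∫⁻ x, ‖avg ν g x - g x‖ₑ ^ p.toReal ∂μ ≤ δ ^ p.toReal := by
    calc ∫⁻ x, ‖avg ν g x - g x‖ₑ ^ p.toReal ∂μ
        ≤ ∫⁻ x, ∫⁻ y, ‖g (x + y) - g x‖ₑ ^ p.toReal ∂ν ∂μ := by
          refine lintegral_mono_ae ?_
          filter_upwards [h2] with x hx
          have hi : Integrable (fun y => g (x + y)) ν :=
            memLp_one_iff_integrable.1 (hx.mono_exponent hp)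
          have hx' : MemLp (fun y => g (x + y) - g x) p ν := hx.sub (memLp_const _)
          have e : avg ν g x - g x = ∫ y, (g (x + y) - g x) ∂ν := by
            rw [integral_sub hi (integrable_const _)]; simp [avg]
          have : ‖avg ν g x - g x‖ₑ ≤ eLpNorm (fun y => g (x + y) - g x) p ν := by
            rw [e]
            refine (enorm_integral_le_lintegral_enorm _).trans ?_
            rw [← eLpNorm_one_eq_lintegral_enorm]
            exact eLpNorm_le_eLpNorm_of_exponent_le hp hx'.1
          refine (ENNReal.rpow_le_rpow this hpr.le).trans ?_
          rw [eLpNorm_eq_lintegral_rpow_enorm_toReal hp0 hp', ← ENNReal.rpow_mul,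
            one_div_mul_cancel hpr.ne', ENNReal.rpow_one]
      _ = ∫⁻ y, ∫⁻ x, ‖g (x + y) - g x‖ₑ ^ p.toReal ∂μ ∂ν := by
          rw [lintegral_lintegral_swap]
          exact (h1.1.enorm.pow_const p.toReal).prod_swap
      _ ≤ ∫⁻ _, δ ^ p.toReal ∂ν := by
          refine lintegral_mono_ae ?_
          filter_upwards [hδ] with y hy
          refine le_trans (le_of_eq ?_) (ENNReal.rpow_le_rpow hy hpr.le)
          rw [eLpNorm_eq_lintegral_rpow_enorm_toReal hp0 hp', ← ENNReal.rpow_mul,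
            one_div_mul_cancel hpr.ne', ENNReal.rpow_one]
      _ = δ ^ p.toReal := by simp
  rw [eLpNorm_eq_lintegral_rpow_enorm_toReal hp0 hp']
  calc _ ≤ (δ ^ p.toReal) ^ (1 / p.toReal) := ENNReal.rpow_le_rpow key (by positivity)
    _ = δ := by rw [← ENNReal.rpow_mul, mul_one_div_cancel hpr.ne', ENNReal.rpow_one]

/-- The difference from g has norm at most twice that of g, by translation invariance. -/
theorem memLp_avg (hp : 1 ≤ p) (hp' : p ≠ ⊤) {g : F → ℝ} (hg : MemLp g p μ) :
    MemLp (avg ν g) p μ := by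
  have h : MemLp (fun x => avg ν g x - g x) p μ := by
    refine ⟨(aestronglyMeasurable_avg hg).sub hg.1, lt_of_le_of_lt
      (eLpNorm_avg_sub_le (δ := eLpNorm g p μ + eLpNorm g p μ) hp hp' hg
        (Eventually.of_forall fun y => ?_)) ?_⟩
    · have hm := measurePreserving_add_right μ y
      refine (eLpNorm_sub_le (hg.comp_measurePreserving hm).1 hg.1 hp).trans ?_
      rw [eLpNorm_comp_measurePreserving hg.1 hm]
    · exact ENNReal.add_lt_top.2 ⟨hg.2, hg.2⟩
  have e : avg ν g = (fun x => avg ν g x - g x) + g := by ext x; simp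
  rw [e]
  exact h.add hg

theorem tendsto_eLpNorm_avg_sub (hp : 1 ≤ p) (hp' : p ≠ ⊤) {g : F → ℝ} (hg : MemLp g p μ)
    {ι : Type*} {l : Filter ι} {ν : ι → Measure F} (hν : ∀ᶠ i in l, IsProbabilityMeasure (ν i))
    (hconc : ∀ U ∈ 𝓝 (0 : F), ∀ᶠ i in l, ∀ᵐ y ∂(ν i), y ∈ U) :
    Tendsto (fun i => eLpNorm (fun x => avg (ν i) g x - g x) p μ) l (𝓝 0) := by
  rw [ENNReal.tendsto_nhds_zero]
  intro ε hε
  have h := ENNReal.tendsto_nhds_zero.1 (tendsto_eLpNorm_translate_sub hp hp' hg) ε hε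
  filter_upwards [hν, hconc _ h] with i hi hc
  exact eLpNorm_avg_sub_le hp hp' hg hc

end Translation

end Aniso

namespace Aniso

/-! ### Mollification as averaging against a bump density. -/

section Mollify

variable {F : Type*} [NormedAddCommGroup F] [NormedSpace ℝ F] [FiniteDimensional ℝ F]
  [MeasureSpace F] [BorelSpace F] [(volume : Measure F).IsAddHaarMeasure] [HasContDiffBump F]

/-- The probability measure whose density is a normalized bump function. -/
noncomputable def bumpMeasure (ρ : ContDiffBump (0 : F)) : Measure F :=
  volume.withDensity fun y => ENNReal.ofReal (ρ.normed volume y)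

instance (ρ : ContDiffBump (0 : F)) : IsProbabilityMeasure (bumpMeasure ρ) := by
  refine ⟨?_⟩
  rw [bumpMeasure, withDensity_apply _ MeasurableSet.univ, Measure.restrict_univ,
    ← ofReal_integral_eq_lintegral_ofReal ρ.integrable_normed
      (Eventually.of_forall ρ.nonneg_normed), ρ.integral_normed, ENNReal.ofReal_one]

theorem ae_bumpMeasure_mem_ball (ρ : ContDiffBump (0 : F)) :
    ∀ᵐ y ∂(bumpMeasure ρ), y ∈ Metric.ball (0 : F) ρ.rOut := by
  rw [bumpMeasure, ae_withDensity_iff (by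
    exact ENNReal.measurable_ofReal.comp ρ.continuous_normed.measurable)]
  refine Eventually.of_forall fun y hy => ?_
  rw [← ρ.support_normed_eq (μ := volume)]
  intro h
  exact hy (by simp [h])

/-- The average involves g(x + y) while a convolution involves ρ(x - y); evenness of the bump
reconciles the signs. -/
theorem avg_bumpMeasure (ρ : ContDiffBump (0 : F)) (g : F → ℝ) (x : F) :
    avg (bumpMeasure ρ) g x = ∫ y, ρ.normed volume (x - y) * g y := by
  have hm : Measurable fun y : F => ENNReal.ofReal (ρ.normed volume y) :=
    ENNReal.measurable_ofReal.comp ρ.continuous_normed.measurable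
  rw [avg, bumpMeasure, integral_withDensity_eq_integral_toReal_smul hm (by simp)]
  rw [← integral_sub_left_eq_self (fun y => ρ.normed volume (x - y) * g y) volume x,
    ← integral_neg_eq_self]
  refine integral_congr_ae (Eventually.of_forall fun y => ?_)
  simp [ENNReal.toReal_ofReal, ρ.nonneg_normed, ContDiffBump.normed_neg, ← sub_eq_add_neg]

theorem avg_bumpMeasure_eq_convolution (ρ : ContDiffBump (0 : F)) (g : F → ℝ) :
    avg (bumpMeasure ρ) g =
      convolution (ρ.normed volume) g (ContinuousLinearMap.lsmul ℝ ℝ) volume := by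
  ext x
  rw [avg_bumpMeasure, convolution_lsmul_swap]
  simp

theorem contDiff_avg_bumpMeasure (ρ : ContDiffBump (0 : F)) {g : F → ℝ} (hg : Integrable g) :
    ContDiff ℝ ∞ (avg (bumpMeasure ρ) g) := by
  rw [avg_bumpMeasure_eq_convolution]
  exact ρ.hasCompactSupport_normed.contDiff_convolution_left _ ρ.contDiff_normed
    hg.locallyIntegrable

theorem fderiv_avg_bumpMeasure (ρ : ContDiffBump (0 : F)) {g : F → ℝ} (hg : Integrable g)
    (x e : F) : fderiv ℝ (avg (bumpMeasure ρ) g) x e =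
      ∫ y, fderiv ℝ (ρ.normed volume) (x - y) e * g y := by
  rw [avg_bumpMeasure_eq_convolution]
  have hc : HasCompactSupport (fderiv ℝ (ρ.normed (volume : Measure F))) :=
    ρ.hasCompactSupport_normed.fderiv ℝ
  have hd : Continuous (fderiv ℝ (ρ.normed (volume : Measure F))) :=
    (ρ.contDiff_normed (n := 1)).continuous_fderiv (by simp)
  rw [(ρ.hasCompactSupport_normed.hasFDerivAt_convolution_left _ ρ.contDiff_normed
    hg.locallyIntegrable x).fderiv, convolution_eq_swap]
  have hex : ConvolutionExistsAt (fderiv ℝ (ρ.normed (volume : Measure F))) g x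
      ((ContinuousLinearMap.lsmul ℝ ℝ).precompL F) volume :=
    hc.convolutionExists_left _ hd hg.locallyIntegrable x
  rw [ContinuousLinearMap.integral_apply]
  · refine integral_congr_ae (Eventually.of_forall fun y => ?_)
    simp [ContinuousLinearMap.precompL_apply]
  · exact hex.integrable_swap

end Mollify

/-! ### Weak gradients under mollification and subtraction. -/

section WeakGradient

variable {N : ℕ} {Ω : Set (E N)}

/-- The zero extension of k need not have a weak gradient across ∂Ω. But if the closed ball lies in
Ω, then y ↦ ρ(x - y) is a test function in Ω, and the sign from differentiating it cancels the one
in the definition of the weak derivative. -/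
theorem pd_avg_bumpMeasure (hΩ : IsOpen Ω) {k : E N → ℝ} {D : E N → E N} (hk : IsW11 Ω k D)
    (ρ : ContDiffBump (0 : E N)) {x : E N} (hx : Metric.closedBall x ρ.rOut ⊆ Ω) (j : Fin N) :
    pd j (avg (bumpMeasure ρ) (Ω.indicator k)) x =
      avg (bumpMeasure ρ) (Ω.indicator fun y => D y j) x := by
  have hki : Integrable (Ω.indicator k) := (integrable_indicator_iff hΩ.measurableSet).2 hk.integrable
  have hs : ContDiff ℝ ∞ (ρ.normed (volume : Measure (E N))) := ρ.contDiff_normed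
  have hsup : (Function.support fun y => ρ.normed volume (x - y)) ⊆ Metric.closedBall x ρ.rOut := by
    intro y hy
    have : x - y ∈ Function.support (ρ.normed (volume : Measure (E N))) := hy
    rw [ρ.support_normed_eq] at this
    simp only [Metric.mem_ball, dist_zero_right] at this
    rw [Metric.mem_closedBall, dist_comm, dist_eq_norm]
    exact this.le
  have ht : IsTest Ω (fun y => ρ.normed volume (x - y)) :=
    { smooth := hs.comp (by fun_prop)
      compact := HasCompactSupport.of_support_subset_isCompact (isCompact_closedBall x ρ.rOut) hsup
      support := (closure_minimal hsup Metric.isClosed_closedBall).trans hx }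
  have hpd : ∀ y, pd j (fun y => ρ.normed volume (x - y)) y =
      - fderiv ℝ (ρ.normed volume) (x - y) (EuclideanSpace.single j 1) := by
    intro y
    have h1 : HasFDerivAt (ρ.normed volume) (fderiv ℝ (ρ.normed volume) (x - y)) (x - y) :=
      (hs.differentiable (by simp) _).hasFDerivAt
    have h2 := h1.comp y ((hasFDerivAt_id y).const_sub x)
    have h3 : fderiv ℝ (fun y => ρ.normed volume (x - y)) y = _ := h2.fderiv
    rw [pd, h3]
    simp
  have hw := hk.weak j _ ht
  simp_rw [hpd] at hw
  rw [pd, fderiv_avg_bumpMeasure ρ hki, avg_bumpMeasure]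
  have e1 : (fun y => fderiv ℝ (ρ.normed volume) (x - y) (EuclideanSpace.single j 1) *
      Ω.indicator k y) = Ω.indicator fun y =>
        fderiv ℝ (ρ.normed volume) (x - y) (EuclideanSpace.single j 1) * k y := by
    ext y; by_cases h : y ∈ Ω <;> simp [h]
  have e2 : (fun y => ρ.normed volume (x - y) * Ω.indicator (fun y => D y j) y) =
      Ω.indicator fun y => D y j * ρ.normed volume (x - y) := by
    ext y; by_cases h : y ∈ Ω <;> simp [h, mul_comm]
  rw [e1, e2, integral_indicator hΩ.measurableSet, integral_indicator hΩ.measurableSet]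
  simp only [mul_neg, integral_neg, neg_inj] at hw
  rw [← hw]
  exact integral_congr_ae (Eventually.of_forall fun y => mul_comm _ _)

theorem IsW11.sub {v w : E N → ℝ} {D D' : E N → E N} (hv : IsW11 Ω v D) (hw : IsW11 Ω w D') :
    IsW11 Ω (fun x => v x - w x) (fun x => D x - D' x) where
  integrable := hv.integrable.sub hw.integrable
  integrable_grad j := by simpa using! (hv.integrable_grad j).sub (hw.integrable_grad j)
  weak j φ hφ := by
    have hb : ∃ C, ∀ x, ‖φ x‖ ≤ C := hφ.smooth.continuous.bounded_above_of_compact_support hφ.compact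
    have hd : Continuous (pd j φ) := by
      have := hφ.smooth.continuous_fderiv (by simp)
      exact this.clm_apply continuous_const
    have hdc : HasCompactSupport (pd j φ) :=
      hφ.compact.fderiv_apply (𝕜 := ℝ) (EuclideanSpace.single j 1)
    obtain ⟨C, hC⟩ := hb
    obtain ⟨C', hC'⟩ := hd.bounded_above_of_compact_support hdc
    have i1 : ∀ {f : E N → ℝ}, Integrable f (volume.restrict Ω) →
        Integrable (fun x => f x * pd j φ x) (volume.restrict Ω) := fun hf =>
      hf.mul_bdd hd.aestronglyMeasurable (Eventually.of_forall hC')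
    have i2 : ∀ {f : E N → ℝ}, Integrable f (volume.restrict Ω) →
        Integrable (fun x => f x * φ x) (volume.restrict Ω) := fun hf =>
      hf.mul_bdd hφ.smooth.continuous.aestronglyMeasurable (Eventually.of_forall hC)
    simp only [sub_mul, PiLp.sub_apply]
    rw [integral_sub (i1 hv.integrable) (i1 hw.integrable),
      integral_sub (i2 (hv.integrable_grad j)) (i2 (hw.integrable_grad j)),
      hv.weak j φ hφ, hw.weak j φ hφ]
    ring

end WeakGradient

end Aniso

/-! ### Cutoffs, and approximation of H(w) by test functions. -/

namespace Aniso

/-- `H` is a smooth nondecreasing function with values in `[0, 1]` that vanishes on `(-∞, 0]` and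
has bounded derivative. -/
structure IsCutoff (H : ℝ → ℝ) (M : ℝ) : Prop where
  smooth : ContDiff ℝ ∞ H
  zero : ∀ s ≤ 0, H s = 0
  mono : Monotone H
  le_one : ∀ s, H s ≤ 1
  deriv_le : ∀ s, |deriv H s| ≤ M

namespace IsCutoff

variable {H : ℝ → ℝ} {M : ℝ} (h : IsCutoff H M)
include h

theorem nonneg (s : ℝ) : 0 ≤ H s := by
  rw [← h.zero (min s 0) (min_le_right _ _)]
  exact h.mono (min_le_left _ _)

theorem continuous : Continuous H := h.smooth.continuous

theorem continuous_deriv : Continuous (deriv H) := h.smooth.continuous_deriv (by simp)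

theorem hasDerivAt (s : ℝ) : HasDerivAt H (deriv H s) s :=
  (h.smooth.differentiable (by simp) s).hasDerivAt

theorem deriv_nonneg (s : ℝ) : 0 ≤ deriv H s := h.mono.deriv_nonneg

theorem deriv_eq_zero {s : ℝ} (hs : s ≤ 0) : deriv H s = 0 := by
  have hneg : ∀ s < 0, deriv H s = 0 := fun s hs => by
    have : H =ᶠ[𝓝 s] fun _ => 0 := by
      filter_upwards [Iio_mem_nhds hs] with x hx using h.zero x (le_of_lt hx)
    rw [this.deriv_eq]; simp
  have hc : IsClosed {s | deriv H s = 0} := isClosed_eq h.continuous_deriv continuous_const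
  have : Set.Iic (0 : ℝ) ⊆ {s | deriv H s = 0} := by
    rw [← closure_Iio]
    exact closure_minimal hneg hc
  exact this hs

theorem abs_le_one (s : ℝ) : |H s| ≤ 1 := by
  rw [abs_of_nonneg (h.nonneg s)]; exact h.le_one s

end IsCutoff

theorem tendsto_eLpNorm_zero_of_subseq {α : Type*} [MeasurableSpace α] {μ : Measure α} {p : ℝ≥0∞}
    {f : ℕ → α → ℝ} (h : Tendsto (fun n => eLpNorm (f n) p μ) atTop (𝓝 0)) {ns : ℕ → ℕ}
    (hns : StrictMono ns) : Tendsto (fun n => eLpNorm (f (ns n)) p μ) atTop (𝓝 0) :=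
  h.comp hns.tendsto_atTop

theorem tendsto_eLpNorm_zero_of_le {α : Type*} [MeasurableSpace α] {μ : Measure α} {p : ℝ≥0∞}
    {ι : Type*} {l : Filter ι} {f g : ι → α → ℝ} (hg : Tendsto (fun n => eLpNorm (g n) p μ) l (𝓝 0))
    {C : ℝ} (hfg : ∀ n, ∀ᵐ x ∂μ, |f n x| ≤ C * |g n x|) :
    Tendsto (fun n => eLpNorm (f n) p μ) l (𝓝 0) := by
  have h1 : ∀ n, eLpNorm (f n) p μ ≤ ENNReal.ofReal C * eLpNorm (g n) p μ := fun n =>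
    eLpNorm_le_mul_eLpNorm_of_ae_le_mul (hfg n) p
  have h2 := ENNReal.Tendsto.const_mul (a := ENNReal.ofReal C) hg (Or.inr (by simp))
  rw [mul_zero] at h2
  exact tendsto_of_tendsto_of_tendsto_of_le_of_le tendsto_const_nhds h2 (fun _ => zero_le) h1

theorem tendsto_eLpNorm_zero_add {α : Type*} [MeasurableSpace α] {μ : Measure α} {p : ℝ≥0∞}
    (hp : 1 ≤ p) {ι : Type*} {l : Filter ι} {f g : ι → α → ℝ}
    (hfm : ∀ n, AEStronglyMeasurable (f n) μ) (hgm : ∀ n, AEStronglyMeasurable (g n) μ)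
    (hf : Tendsto (fun n => eLpNorm (f n) p μ) l (𝓝 0))
    (hg : Tendsto (fun n => eLpNorm (g n) p μ) l (𝓝 0)) :
    Tendsto (fun n => eLpNorm (fun x => f n x + g n x) p μ) l (𝓝 0) := by
  have h2 := hf.add hg
  rw [add_zero] at h2
  exact tendsto_of_tendsto_of_tendsto_of_le_of_le tendsto_const_nhds h2 (fun _ => zero_le)
    fun n => eLpNorm_add_le (hfm n) (hgm n) hp

theorem one_le_ofReal {p : ℝ} (hp : 1 < p) : 1 ≤ ENNReal.ofReal p := by
  rw [← ENNReal.ofReal_one]; exact ENNReal.ofReal_le_ofReal hp.le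

variable {N : ℕ} {Ω : Set (E N)}

theorem IsTest.continuous_pd {U : Set (E N)} {φ : E N → ℝ} (hφ : IsTest U φ) (j : Fin N) :
    Continuous (pd j φ) :=
  (hφ.smooth.continuous_fderiv (by simp)).clm_apply continuous_const

theorem IsTest.hasCompactSupport_pd {U : Set (E N)} {φ : E N → ℝ} (hφ : IsTest U φ) (j : Fin N) :
    HasCompactSupport (pd j φ) :=
  hφ.compact.fderiv_apply (𝕜 := ℝ) (EuclideanSpace.single j 1)

/-- A sequence of mollifiers. -/
noncomputable def bump (F : Type*) [NormedAddCommGroup F] (n : ℕ) : ContDiffBump (0 : F) where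
  rIn := 1 / (n + 1) / 2
  rOut := 1 / (n + 1)
  rIn_pos := by positivity
  rIn_lt_rOut := half_lt_self (by positivity)

theorem tendsto_eLpNorm_mollify_sub {p : ℝ≥0∞} (hp : 1 ≤ p) (hp' : p ≠ ⊤) {g : E N → ℝ}
    (hg : MemLp g p) :
    Tendsto (fun n => eLpNorm (fun x => avg (bumpMeasure (bump (E N) n)) g x - g x) p volume)
      atTop (𝓝 0) := by
  refine tendsto_eLpNorm_avg_sub hp hp' hg (Eventually.of_forall fun n => inferInstance) ?_
  intro U hU
  obtain ⟨ε, hε, hb⟩ := Metric.mem_nhds_iff.1 hU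
  have := (tendsto_one_div_add_atTop_nhds_zero_nat (𝕜 := ℝ)).eventually (gt_mem_nhds hε)
  filter_upwards [this] with n hn
  filter_upwards [ae_bumpMeasure_mem_ball (bump (E N) n)] with y hy
  exact hb (Metric.ball_subset_ball hn.le hy)

/-- The mollification of k ≥ 0 is nonnegative everywhere, so off the support of φ the argument of H
is nonpositive and H vanishes there. The gradient formula holds off that support too, where
mollification and gradient may fail to commute, because H' is 0 on (-∞, 0]. -/
theorem exists_test_below (hΩ : IsOpen Ω) {H : ℝ → ℝ} {M : ℝ} (hH : IsCutoff H M)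
    {φ k : E N → ℝ} {Dk : E N → E N} (hφ : IsTest Ω φ) (hk : IsW11 Ω k Dk)
    (hk0 : ∀ᵐ x ∂(volume.restrict Ω), 0 ≤ k x) (ρ : ContDiffBump (0 : E N))
    (hρ : ∀ x ∈ tsupport φ, Metric.closedBall x ρ.rOut ⊆ Ω) :
    IsTest Ω (fun x => H (φ x - avg (bumpMeasure ρ) (Ω.indicator k) x)) ∧
    ∀ j x, pd j (fun x => H (φ x - avg (bumpMeasure ρ) (Ω.indicator k) x)) x =
      deriv H (φ x - avg (bumpMeasure ρ) (Ω.indicator k) x) *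
        (pd j φ x - avg (bumpMeasure ρ) (Ω.indicator fun y => Dk y j) x) := by
  have hki : Integrable (Ω.indicator k) := (integrable_indicator_iff hΩ.measurableSet).2 hk.integrable
  have hs := contDiff_avg_bumpMeasure ρ hki
  have h0 : ∀ x ∉ tsupport φ, φ x - avg (bumpMeasure ρ) (Ω.indicator k) x ≤ 0 := by
    intro x hx
    rw [image_eq_zero_of_notMem_tsupport hx, zero_sub, neg_nonpos]
    rw [avg_bumpMeasure]
    refine integral_nonneg_of_ae ?_
    filter_upwards [(ae_restrict_iff' hΩ.measurableSet).1 hk0] with y hy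
    exact mul_nonneg (ρ.nonneg_normed _) (Set.indicator_apply_nonneg hy)
  have hsub : (Function.support fun x => H (φ x - avg (bumpMeasure ρ) (Ω.indicator k) x)) ⊆
      tsupport φ := by
    intro x hx
    by_contra h
    exact hx (hH.zero _ (h0 x h))
  refine ⟨⟨hH.smooth.comp (hφ.smooth.sub hs), HasCompactSupport.of_support_subset_isCompact
    hφ.compact hsub, (closure_minimal hsub (isClosed_tsupport φ)).trans hφ.support⟩, fun j x => ?_⟩
  have h1 := (hH.hasDerivAt (φ x - avg (bumpMeasure ρ) (Ω.indicator k) x)).hasFDerivAt.comp x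
    ((hφ.smooth.differentiable (by simp) x).hasFDerivAt.sub
      (hs.differentiable (by simp) x).hasFDerivAt)
  have h2 : fderiv ℝ (fun x => H (φ x - avg (bumpMeasure ρ) (Ω.indicator k) x)) x = _ := h1.fderiv
  rw [pd, h2]
  by_cases hx : x ∈ tsupport φ
  · rw [← pd_avg_bumpMeasure hΩ hk ρ (hρ x hx) j]
    simp [pd]
    ring
  · simp [hH.deriv_eq_zero (h0 x hx)]

/-- Write w = η - k with k = η - w ≥ 0, approximate η by test functions φ and k by mollifications,
and apply H to the differences r. Only the one-sided bound w ≤ η is needed. The gradient error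
splits into H'(r)(∇r - ∇w), small since H' is bounded, and (H'(r) - H'(w))∇w, handled by dominated
convergence. -/
theorem exists_test_approx (hΩ : IsOpen Ω) (hΩb : Bornology.IsBounded Ω) {p : Fin N → ℝ}
    (hp : ∀ j, 1 < p j) {w η : E N → ℝ} {Dw Dη : E N → E N} (hη : IsW1p0 Ω p η Dη)
    (hw : IsW11 Ω w Dw)
    (hwp : ∀ j, MemLp (fun x => Dw x j) (ENNReal.ofReal (p j)) (volume.restrict Ω))
    (hle : ∀ᵐ x ∂(volume.restrict Ω), w x ≤ η x) {H : ℝ → ℝ} {M : ℝ} (hH : IsCutoff H M) :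
    ∃ ψ : ℕ → E N → ℝ, (∀ n, IsTest Ω (ψ n)) ∧
      Tendsto (fun n => eLpNorm (fun x => ψ n x - H (w x)) 2 (volume.restrict Ω)) atTop (𝓝 0) ∧
      ∀ j, Tendsto (fun n => eLpNorm (fun x => pd j (ψ n) x - deriv H (w x) * Dw x j)
        (ENNReal.ofReal (p j)) (volume.restrict Ω)) atTop (𝓝 0) := by
  have hfin : IsFiniteMeasure (volume.restrict Ω) :=
    ⟨by rw [Measure.restrict_apply_univ]; exact hΩb.measure_lt_top⟩
  have hm := hΩ.measurableSet
  have hp1 : ∀ j, 1 ≤ ENNReal.ofReal (p j) := fun j => one_le_ofReal (hp j)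
  have hk : IsW11 Ω (fun x => η x - w x) (fun x => Dη x - Dw x) := hη.toIsW11.sub hw
  have hk0 : ∀ᵐ x ∂(volume.restrict Ω), 0 ≤ η x - w x := by
    filter_upwards [hle] with x hx using sub_nonneg.2 hx
  set K := Ω.indicator fun x => η x - w x with hK
  set DK : Fin N → E N → ℝ := fun j => Ω.indicator fun x => (Dη x - Dw x) j with hDK
  have hKL : MemLp K 1 := (memLp_indicator_iff_restrict hm).2 (memLp_one_iff_integrable.2 hk.integrable)
  have hDKL : ∀ j, MemLp (DK j) (ENNReal.ofReal (p j)) := fun j =>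
    (memLp_indicator_iff_restrict hm).2 ((hη.memLp_grad j).sub (hwp j))
  have heps : Tendsto (fun n : ℕ => ENNReal.ofReal (1 / ((n : ℝ) + 1))) atTop (𝓝 0) := by
    have := ENNReal.tendsto_ofReal (tendsto_one_div_add_atTop_nhds_zero_nat (𝕜 := ℝ))
    simpa using this
  have hpos : ∀ n : ℕ, (0 : ℝ) < 1 / ((n : ℝ) + 1) := fun n => by positivity
  choose φ hφ hφε using fun n : ℕ => hη.closure (1 / ((n : ℝ) + 1)) (hpos n)
  -- The mollification scale is chosen after φ n: fine enough that balls centred in its compact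
  -- support stay in Ω, and that all mollification errors are at most 1/(n+1).
  have hm' : ∀ n, ∃ m, (∀ x ∈ tsupport (φ n), Metric.closedBall x (bump (E N) m).rOut ⊆ Ω) ∧
      eLpNorm (fun x => avg (bumpMeasure (bump (E N) m)) K x - K x) 1 volume
        ≤ ENNReal.ofReal (1 / ((n : ℝ) + 1)) ∧
      ∀ j, eLpNorm (fun x => avg (bumpMeasure (bump (E N) m)) (DK j) x - DK j x)
        (ENNReal.ofReal (p j)) volume ≤ ENNReal.ofReal (1 / ((n : ℝ) + 1)) := by
    intro n
    obtain ⟨δ, hδ, hsub⟩ := (hφ n).compact.exists_cthickening_subset_open hΩ (hφ n).support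
    have e0 : ENNReal.ofReal (1 / ((n : ℝ) + 1)) > 0 := ENNReal.ofReal_pos.2 (hpos n)
    have h1 := (tendsto_one_div_add_atTop_nhds_zero_nat (𝕜 := ℝ)).eventually (gt_mem_nhds hδ)
    have h2 := ENNReal.tendsto_nhds_zero.1 (tendsto_eLpNorm_mollify_sub le_rfl (by simp) hKL) _ e0
    have h3 := fun j => ENNReal.tendsto_nhds_zero.1
      (tendsto_eLpNorm_mollify_sub (hp1 j) (by simp) (hDKL j)) _ e0
    obtain ⟨m, a1, a2, a3⟩ := (h1.and (h2.and (eventually_all.2 h3))).exists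
    refine ⟨m, fun x hx => ?_, a2, a3⟩
    exact (Metric.closedBall_subset_closedBall a1.le).trans
      ((Metric.closedBall_subset_cthickening hx δ).trans hsub)
  choose m hball hmK hmD using hm'
  set ρ : ℕ → ContDiffBump (0 : E N) := fun n => bump (E N) (m n) with hρ
  set r : ℕ → E N → ℝ := fun n x => φ n x - avg (bumpMeasure (ρ n)) K x with hr
  have htest := fun n => exists_test_below hΩ hH (hφ n) hk hk0 (ρ n) (hball n)
  have hcφ : ∀ n, Continuous (φ n) := fun n => (hφ n).smooth.continuous
  have hcK : ∀ n, Continuous (avg (bumpMeasure (ρ n)) K) := fun n =>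
    (contDiff_avg_bumpMeasure (ρ n) (memLp_one_iff_integrable.1 hKL)).continuous
  have hcr : ∀ n, Continuous (r n) := fun n => (hcφ n).sub (hcK n)
  have hsq : ∀ {f : ℕ → ℝ≥0∞}, (∀ n, f n ≤ ENNReal.ofReal (1 / ((n : ℝ) + 1))) →
      Tendsto f atTop (𝓝 0) := fun hf =>
    tendsto_of_tendsto_of_tendsto_of_le_of_le tendsto_const_nhds heps (fun _ => zero_le) hf
  have t1 : Tendsto (fun n => eLpNorm (fun x => η x - φ n x) 1 (volume.restrict Ω)) atTop (𝓝 0) :=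
    hsq fun n => le_self_add.trans (hφε n).le
  have t2 : ∀ j, Tendsto (fun n => eLpNorm (fun x => Dη x j - pd j (φ n) x)
      (ENNReal.ofReal (p j)) (volume.restrict Ω)) atTop (𝓝 0) := fun j =>
    hsq fun n => ((Finset.single_le_sum (f := fun j => eLpNorm (fun x => Dη x j - pd j (φ n) x)
      (ENNReal.ofReal (p j)) (volume.restrict Ω)) (fun _ _ => zero_le) (Finset.mem_univ j)).trans
        le_add_self).trans (hφε n).le
  have t3 : Tendsto (fun n => eLpNorm (fun x => avg (bumpMeasure (ρ n)) K x - K x) 1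
      (volume.restrict Ω)) atTop (𝓝 0) :=
    hsq fun n => (eLpNorm_mono_measure _ Measure.restrict_le_self).trans (hmK n)
  have t4 : ∀ j, Tendsto (fun n => eLpNorm (fun x => avg (bumpMeasure (ρ n)) (DK j) x - DK j x)
      (ENNReal.ofReal (p j)) (volume.restrict Ω)) atTop (𝓝 0) := fun j =>
    hsq fun n => (eLpNorm_mono_measure _ Measure.restrict_le_self).trans (hmD n j)
  have hKm : AEStronglyMeasurable K (volume.restrict Ω) := hKL.1.restrict
  have hDKm : ∀ j n, AEStronglyMeasurable (fun x => avg (bumpMeasure (ρ n)) (DK j) x - DK j x)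
      (volume.restrict Ω) := fun j n =>
    ((aestronglyMeasurable_avg (hDKL j)).sub (hDKL j).1).restrict
  have hφDm : ∀ j n, AEStronglyMeasurable (fun x => Dη x j - pd j (φ n) x) (volume.restrict Ω) :=
    fun j n => (hη.memLp_grad j).1.sub ((hφ n).continuous_pd j).aestronglyMeasurable
  have hrw : Tendsto (fun n => eLpNorm (r n - w) 1 (volume.restrict Ω)) atTop (𝓝 0) := by
    refine tendsto_eLpNorm_zero_of_le (C := 1) (tendsto_eLpNorm_zero_add le_rfl
      (fun n => hη.integrable.1.sub (hcφ n).aestronglyMeasurable)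
      (fun n => (hcK n).aestronglyMeasurable.sub hKm) t1 t3) fun n => ?_
    filter_upwards [ae_restrict_mem hm] with x hx
    rw [one_mul, ← abs_neg]
    refine le_of_eq (congrArg _ ?_)
    simp only [Pi.sub_apply, hr, hK, Set.indicator_of_mem hx]
    ring
  -- A subsequence makes r → w almost everywhere, which dominated convergence for H(r) and H'(r)
  -- requires.
  obtain ⟨ns, hns, hae⟩ := (tendstoInMeasure_of_tendsto_eLpNorm one_ne_zero
    (fun n => (hcr n).aestronglyMeasurable) hw.integrable.1 hrw).exists_seq_tendsto_ae
  have hwm := hw.integrable.1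
  refine ⟨fun n x => H (r (ns n) x), fun n => (htest (ns n)).1, ?_, fun j => ?_⟩
  · refine tendsto_eLpNorm_zero_of_dominated (by norm_num) (by simp) (g := fun _ => 2)
      (memLp_const _) (fun n => ?_) (fun n => ?_) ?_
    · exact (hH.continuous.comp (hcr _)).aestronglyMeasurable.sub
        (hH.continuous.comp_aestronglyMeasurable hwm)
    · refine Eventually.of_forall fun x => ?_
      have := abs_sub (H (r (ns n) x)) (H (w x))
      have h1 := hH.abs_le_one (r (ns n) x)
      have h2 := hH.abs_le_one (w x)
      rw [abs_two]
      linarith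
    · filter_upwards [hae] with x hx
      have := ((hH.continuous.tendsto (w x)).comp hx).sub_const (H (w x))
      simpa using this
  · have s1 : Tendsto (fun n => eLpNorm (fun x => deriv H (r (ns n) x) *
        (-((Dη x j - pd j (φ (ns n)) x) + (avg (bumpMeasure (ρ (ns n))) (DK j) x - DK j x))))
        (ENNReal.ofReal (p j)) (volume.restrict Ω)) atTop (𝓝 0) := by
      refine tendsto_eLpNorm_zero_of_le (C := M) (tendsto_eLpNorm_zero_of_subseq
        (tendsto_eLpNorm_zero_add (hp1 j) (hφDm j) (hDKm j) (t2 j) (t4 j)) hns) fun n =>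
          Eventually.of_forall fun x => ?_
      rw [abs_mul, abs_neg]
      exact mul_le_mul_of_nonneg_right (hH.deriv_le _) (abs_nonneg _)
    have hdm : ∀ n, AEStronglyMeasurable (fun x => (deriv H (r (ns n) x) - deriv H (w x)) * Dw x j)
        (volume.restrict Ω) := fun n =>
      ((hH.continuous_deriv.comp (hcr _)).aestronglyMeasurable.sub
        (hH.continuous_deriv.comp_aestronglyMeasurable hwm)).mul (hwp j).1
    have s2 : Tendsto (fun n => eLpNorm (fun x => (deriv H (r (ns n) x) - deriv H (w x)) * Dw x j)
        (ENNReal.ofReal (p j)) (volume.restrict Ω)) atTop (𝓝 0) := by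
      refine tendsto_eLpNorm_zero_of_dominated (hp1 j) (by simp) ((hwp j).const_mul (2 * M)) hdm
        (fun n => Eventually.of_forall fun x => ?_) ?_
      · have h0 := abs_sub (deriv H (r (ns n) x)) (deriv H (w x))
        have h1 := hH.deriv_le (r (ns n) x)
        have h2 := hH.deriv_le (w x)
        rw [abs_mul, abs_mul]
        refine mul_le_mul_of_nonneg_right ((?_ : _ ≤ 2 * M).trans (le_abs_self _)) (abs_nonneg _)
        linarith
      · filter_upwards [hae] with x hx
        have := (((hH.continuous_deriv.tendsto (w x)).comp hx).sub_const (deriv H (w x))).mul_const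
          (Dw x j)
        simpa using this
    refine (tendsto_eLpNorm_zero_add (hp1 j) (fun n => ?_) hdm s1 s2).congr fun n => ?_
    · exact (hH.continuous_deriv.comp (hcr _)).aestronglyMeasurable.mul
        ((hφDm j _).add (hDKm j _)).neg
    · refine eLpNorm_congr_ae ?_
      filter_upwards [ae_restrict_mem hm] with x hx
      rw [(htest (ns n)).2 j x]
      have : DK j x = Dη x j - Dw x j := by simp [hDK, hx]
      rw [this]
      simp only [hr]
      ring

end Aniso

/-! ### Smooth time cutoffs and product test functions. -/

namespace Aniso

theorem contDiff_smoothTransition : ContDiff ℝ ∞ Real.smoothTransition := Real.smoothTransition.contDiff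

theorem continuous_deriv_smoothTransition : Continuous (deriv Real.smoothTransition) :=
  contDiff_smoothTransition.continuous_deriv (by simp)

theorem hasDerivAt_smoothTransition (s : ℝ) : HasDerivAt Real.smoothTransition (deriv Real.smoothTransition s) s :=
  (contDiff_smoothTransition.differentiable (by simp) s).hasDerivAt

theorem deriv_smoothTransition_support : (Function.support (deriv Real.smoothTransition)) ⊆ Set.Icc 0 1 := by
  intro s hs
  by_contra h
  refine hs ?_
  rw [Set.mem_Icc, not_and_or, not_le, not_le] at h
  rcases h with h | h
  · have : Real.smoothTransition =ᶠ[𝓝 s] fun _ => 0 := by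
      filter_upwards [Iio_mem_nhds h] with x hx using Real.smoothTransition.zero_of_nonpos (le_of_lt hx)
    rw [this.deriv_eq]; simp
  · have : Real.smoothTransition =ᶠ[𝓝 s] fun _ => 1 := by
      filter_upwards [Ioi_mem_nhds h] with x hx using Real.smoothTransition.one_of_one_le (le_of_lt hx)
    rw [this.deriv_eq]; simp

theorem hasCompactSupport_deriv_smoothTransition : HasCompactSupport (deriv Real.smoothTransition) :=
  HasCompactSupport.of_support_subset_isCompact isCompact_Icc deriv_smoothTransition_support

theorem integrable_deriv_smoothTransition : Integrable (deriv Real.smoothTransition) :=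
  continuous_deriv_smoothTransition.integrable_of_hasCompactSupport
    hasCompactSupport_deriv_smoothTransition

theorem integral_deriv_smoothTransition : ∫ y, deriv Real.smoothTransition y = 1 := by
  have h := integral_of_hasDerivAt_of_tendsto (f := Real.smoothTransition) (m := 0) (n := 1) hasDerivAt_smoothTransition
    integrable_deriv_smoothTransition ?_ ?_
  · simpa using h
  · refine tendsto_const_nhds.congr' ?_
    filter_upwards [eventually_le_atBot (0 : ℝ)] with x hx
    exact (Real.smoothTransition.zero_of_nonpos hx).symm
  · refine tendsto_const_nhds.congr' ?_
    filter_upwards [eventually_ge_atTop (1 : ℝ)] with x hx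
    exact (Real.smoothTransition.one_of_one_le hx).symm

/-- The substitution y = (n+1)(τ - s) turns the integral into an average of q(s + y/(n+1)) against a
fixed density supported in [0, 1] with integral 1. -/
theorem tendsto_integral_approx_right {q : ℝ → ℝ} (hqm : AEStronglyMeasurable q) {C : ℝ}
    (hqC : ∀ τ, |q τ| ≤ C) {s : ℝ} (hs : ContinuousAt q s) :
    Tendsto (fun n : ℕ => ∫ τ, q τ * (((n : ℝ) + 1) * deriv Real.smoothTransition (((n : ℝ) + 1) * (τ - s)))) atTop
      (𝓝 (q s)) := by
  have e : ∀ n : ℕ, ∫ τ, q τ * (((n : ℝ) + 1) * deriv Real.smoothTransition (((n : ℝ) + 1) * (τ - s))) =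
      ∫ y, q (s + ((n : ℝ) + 1)⁻¹ * y) * deriv Real.smoothTransition y := by
    intro n
    have hn : (0 : ℝ) < (n : ℝ) + 1 := by positivity
    rw [← integral_add_left_eq_self _ s]
    have := Measure.integral_comp_mul_left
      (fun y => q (s + ((n : ℝ) + 1)⁻¹ * y) * deriv Real.smoothTransition y) ((n : ℝ) + 1)
    rw [abs_of_pos (inv_pos.2 hn), smul_eq_mul, eq_comm, inv_mul_eq_iff_eq_mul₀ hn.ne',
      ← integral_const_mul] at this
    rw [this]
    refine integral_congr_ae (Eventually.of_forall fun τ => ?_)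
    simp only [add_sub_cancel_left, inv_mul_cancel_left₀ hn.ne']
    ring
  simp_rw [e]
  have h1 : q s = ∫ y, q s * deriv Real.smoothTransition y := by
    rw [integral_const_mul, integral_deriv_smoothTransition, mul_one]
  rw [h1]
  refine tendsto_integral_of_dominated_convergence (fun y => C * |deriv Real.smoothTransition y|) (fun n => ?_)
    (integrable_deriv_smoothTransition.abs.const_mul C) (fun n => ?_) ?_
  · have hn : ((n : ℝ) + 1)⁻¹ ≠ 0 := by positivity
    refine AEStronglyMeasurable.mul ?_ continuous_deriv_smoothTransition.aestronglyMeasurable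
    have hq : Measure.QuasiMeasurePreserving (fun y : ℝ => s + ((n : ℝ) + 1)⁻¹ * y) :=
      (measurePreserving_add_left volume s).quasiMeasurePreserving.comp
        ⟨by fun_prop, by
          rw [Real.map_volume_mul_left hn]
          exact Measure.smul_absolutelyContinuous⟩
    exact hqm.comp_quasiMeasurePreserving hq
  · refine Eventually.of_forall fun y => ?_
    rw [Real.norm_eq_abs, abs_mul]
    exact mul_le_mul_of_nonneg_right (hqC _) (abs_nonneg _)
  · refine Eventually.of_forall fun y => ?_
    refine Tendsto.mul_const _ (hs.tendsto.comp ?_)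
    have : Tendsto (fun n : ℕ => s + ((n : ℝ) + 1)⁻¹ * y) atTop (𝓝 (s + 0 * y)) := by
      refine Tendsto.const_add _ (Tendsto.mul_const _ ?_)
      simpa using (tendsto_one_div_add_atTop_nhds_zero_nat (𝕜 := ℝ))
    simpa using this

/-- A smooth approximation of the indicator function of `(s, t]`. -/
noncomputable def timeCutoff (s t : ℝ) (n : ℕ) (τ : ℝ) : ℝ :=
  Real.smoothTransition (((n : ℝ) + 1) * (τ - s)) - Real.smoothTransition (((n : ℝ) + 1) * (τ - t))

theorem timeCutoff_smooth (s t : ℝ) (n : ℕ) : ContDiff ℝ ∞ (timeCutoff s t n) := by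
  unfold timeCutoff
  exact (contDiff_smoothTransition.comp (by fun_prop)).sub
    (contDiff_smoothTransition.comp (by fun_prop))

theorem deriv_timeCutoff (s t : ℝ) (n : ℕ) (τ : ℝ) : deriv (timeCutoff s t n) τ =
    ((n : ℝ) + 1) * deriv Real.smoothTransition (((n : ℝ) + 1) * (τ - s)) -
      ((n : ℝ) + 1) * deriv Real.smoothTransition (((n : ℝ) + 1) * (τ - t)) := by
  have h : ∀ s, HasDerivAt (fun τ => Real.smoothTransition (((n : ℝ) + 1) * (τ - s)))
      (deriv Real.smoothTransition (((n : ℝ) + 1) * (τ - s)) * (((n : ℝ) + 1) * 1)) τ := fun s =>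
    (hasDerivAt_smoothTransition _).comp τ (((hasDerivAt_id τ).sub_const s).const_mul _)
  have := ((h s).sub (h t)).deriv
  rw [mul_one, mul_comm, mul_comm (deriv Real.smoothTransition (((n : ℝ) + 1) * (τ - t)))] at this
  exact this

theorem abs_timeCutoff_le (s t : ℝ) (n : ℕ) (τ : ℝ) : |timeCutoff s t n τ| ≤ 1 := by
  unfold timeCutoff
  rw [abs_le]
  constructor <;>
  linarith [Real.smoothTransition.nonneg (((n : ℝ) + 1) * (τ - s)),
    Real.smoothTransition.nonneg (((n : ℝ) + 1) * (τ - t)),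
    Real.smoothTransition.le_one (((n : ℝ) + 1) * (τ - s)),
    Real.smoothTransition.le_one (((n : ℝ) + 1) * (τ - t))]

theorem support_timeCutoff {s t : ℝ} (hst : s ≤ t) (n : ℕ) :
    Function.support (timeCutoff s t n) ⊆ Set.Icc s (t + 1 / ((n : ℝ) + 1)) := by
  have hn : (0 : ℝ) < (n : ℝ) + 1 := by positivity
  intro τ hτ
  by_contra h
  refine hτ ?_
  unfold timeCutoff
  rw [Set.mem_Icc, not_and_or, not_le, not_le] at h
  rcases h with h | h
  · rw [Real.smoothTransition.zero_of_nonpos, Real.smoothTransition.zero_of_nonpos, sub_zero]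
    · exact mul_nonpos_of_nonneg_of_nonpos hn.le (by linarith)
    · exact mul_nonpos_of_nonneg_of_nonpos hn.le (by linarith)
  · have h1 : 1 / ((n : ℝ) + 1) ≤ τ - t := by linarith
    have h2 : 1 / ((n : ℝ) + 1) ≤ τ - s := by linarith
    rw [div_le_iff₀' hn] at h1 h2
    rw [Real.smoothTransition.one_of_one_le h1, Real.smoothTransition.one_of_one_le h2, sub_self]

theorem tendsto_smoothTransition_mul (τ s : ℝ) :
    Tendsto (fun n : ℕ => Real.smoothTransition (((n : ℝ) + 1) * (τ - s))) atTop
      (𝓝 ((Set.Ioi s).indicator (fun _ => 1) τ)) := by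
  by_cases h : s < τ
  · rw [Set.indicator_of_mem (Set.mem_Ioi.2 h)]
    refine tendsto_const_nhds.congr' ?_
    have := (tendsto_one_div_add_atTop_nhds_zero_nat (𝕜 := ℝ)).eventually
      (gt_mem_nhds (sub_pos.2 h))
    filter_upwards [this] with n hn
    have hn' : (0 : ℝ) < (n : ℝ) + 1 := by positivity
    rw [div_lt_iff₀' hn'] at hn
    exact (Real.smoothTransition.one_of_one_le hn.le).symm
  · rw [Set.indicator_of_notMem (by simpa using h)]
    refine tendsto_const_nhds.congr fun n => ?_
    have hn' : (0 : ℝ) < (n : ℝ) + 1 := by positivity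
    exact (Real.smoothTransition.zero_of_nonpos
      (mul_nonpos_of_nonneg_of_nonpos hn'.le (by linarith))).symm

theorem tendsto_timeCutoff {s t : ℝ} (hst : s ≤ t) (τ : ℝ) :
    Tendsto (fun n : ℕ => timeCutoff s t n τ) atTop (𝓝 ((Set.Ioc s t).indicator (fun _ => 1) τ)) := by
  have := (tendsto_smoothTransition_mul τ s).sub (tendsto_smoothTransition_mul τ t)
  convert! this using 2
  simp only [Set.indicator, Set.mem_Ioc, Set.mem_Ioi]
  split_ifs <;> grind

variable {N : ℕ} {Ω : Set (E N)} {T : ℝ}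

theorem IsTest.prod {ψ : E N → ℝ} {χ : ℝ → ℝ} (hψ : IsTest Ω ψ) (hχ : ContDiff ℝ ∞ χ) {a b : ℝ}
    (hsup : Function.support χ ⊆ Set.Icc a b) (ha : 0 < a) (hb : b < T) :
    IsTest (cyl Ω T) (fun z => ψ z.1 * χ z.2) := by
  have hc : IsCompact (tsupport ψ ×ˢ Set.Icc a b) := IsCompact.prod hψ.compact isCompact_Icc
  have hs : (Function.support fun z : E N × ℝ => ψ z.1 * χ z.2) ⊆ tsupport ψ ×ˢ Set.Icc a b := by
    intro z hz
    have hz' : ψ z.1 * χ z.2 ≠ 0 := hz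
    exact ⟨subset_tsupport _ (left_ne_zero_of_mul hz'), hsup (right_ne_zero_of_mul hz')⟩
  exact ⟨(hψ.smooth.comp contDiff_fst).mul (hχ.comp contDiff_snd),
    HasCompactSupport.of_support_subset_isCompact hc hs,
    (closure_minimal hs hc.isClosed).trans (Set.prod_mono hψ.support
      fun τ hτ => ⟨ha.trans_le hτ.1, hτ.2.trans_lt hb⟩)⟩

theorem fderiv_mul_prod {ψ : E N → ℝ} {χ : ℝ → ℝ} (hψ : ContDiff ℝ ∞ ψ) (hχ : ContDiff ℝ ∞ χ)
    (z : E N × ℝ) (e : E N × ℝ) : fderiv ℝ (fun z : E N × ℝ => ψ z.1 * χ z.2) z e =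
      fderiv ℝ ψ z.1 e.1 * χ z.2 + ψ z.1 * (deriv χ z.2 * e.2) := by
  have h1 := (hψ.differentiable (by simp) z.1).hasFDerivAt.comp z hasFDerivAt_fst
  have h2 := (hχ.differentiable (by simp) z.2).hasDerivAt.hasFDerivAt.comp z hasFDerivAt_snd
  have h3 : fderiv ℝ (fun z : E N × ℝ => ψ z.1 * χ z.2) z = _ := (h1.mul h2).fderiv
  rw [h3]
  simp
  ring

theorem pdx_mul_prod {ψ : E N → ℝ} {χ : ℝ → ℝ} (hψ : ContDiff ℝ ∞ ψ) (hχ : ContDiff ℝ ∞ χ)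
    (j : Fin N) (z : E N × ℝ) :
    pdx j (fun z : E N × ℝ => ψ z.1 * χ z.2) z = pd j ψ z.1 * χ z.2 := by
  simp [pdx, fderiv_mul_prod hψ hχ, pd]

theorem pdt_mul_prod {ψ : E N → ℝ} {χ : ℝ → ℝ} (hψ : ContDiff ℝ ∞ ψ) (hχ : ContDiff ℝ ∞ χ)
    (z : E N × ℝ) : pdt (fun z : E N × ℝ => ψ z.1 * χ z.2) z = ψ z.1 * deriv χ z.2 := by
  simp [pdt, fderiv_mul_prod hψ hχ]

end Aniso

/-! ### The weak formulation integrated over a time interval. -/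

namespace Aniso

variable {N : ℕ} {Ω : Set (E N)} {T : ℝ}

theorem restrict_cyl (Ω : Set (E N)) (T : ℝ) : (volume : Measure (E N × ℝ)).restrict (cyl Ω T) =
    (volume.restrict Ω).prod (volume.restrict (Set.Ioo 0 T)) := by
  rw [Measure.prod_restrict]; rfl

theorem isFiniteMeasure_restrict (hΩb : Bornology.IsBounded Ω) :
    IsFiniteMeasure ((volume : Measure (E N)).restrict Ω) :=
  ⟨by rw [Measure.restrict_apply_univ]; exact hΩb.measure_lt_top⟩

theorem measurableSet_cyl (hΩ : IsOpen Ω) : MeasurableSet (cyl Ω T) :=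
  hΩ.measurableSet.prod measurableSet_Ioo

theorem prod_Ioc_subset_cyl {s t : ℝ} (hs : 0 < s) (ht : t < T) :
    Ω ×ˢ Set.Ioc s t ⊆ cyl Ω T :=
  Set.prod_mono le_rfl fun _ hτ => ⟨hs.trans hτ.1, hτ.2.trans_lt ht⟩

theorem IsTest.exists_bound {U : Set (E N)} {ψ : E N → ℝ} (hψ : IsTest U ψ) :
    ∃ C, ∀ x, ‖ψ x‖ ≤ C :=
  hψ.smooth.continuous.bounded_above_of_compact_support hψ.compact

theorem IsTest.exists_bound_pd {U : Set (E N)} {ψ : E N → ℝ} (hψ : IsTest U ψ) (j : Fin N) :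
    ∃ C, ∀ x, ‖pd j ψ x‖ ≤ C :=
  (hψ.continuous_pd j).bounded_above_of_compact_support (hψ.hasCompactSupport_pd j)

theorem IsTest.memLp [IsFiniteMeasure ((volume : Measure (E N)).restrict Ω)] {U : Set (E N)}
    {ψ : E N → ℝ} (hψ : IsTest U ψ) {q : ℝ≥0∞} : MemLp ψ q (volume.restrict Ω) := by
  obtain ⟨C, hC⟩ := hψ.exists_bound
  exact MemLp.of_bound hψ.smooth.continuous.aestronglyMeasurable C (Eventually.of_forall hC)

theorem IsTest.memLp_pd [IsFiniteMeasure ((volume : Measure (E N)).restrict Ω)] {U : Set (E N)}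
    {ψ : E N → ℝ} (hψ : IsTest U ψ) (j : Fin N) {q : ℝ≥0∞} :
    MemLp (pd j ψ) q (volume.restrict Ω) := by
  obtain ⟨C, hC⟩ := hψ.exists_bound_pd j
  exact MemLp.of_bound (hψ.continuous_pd j).aestronglyMeasurable C (Eventually.of_forall hC)

theorem integrable_density {f : E N × ℝ → ℝ} {B : E N × ℝ → E N} {μ : Measure (E N × ℝ)}
    (hf : Integrable f μ) (hB : ∀ j, Integrable (fun z => B z j) μ) {U : Set (E N)} {ψ : E N → ℝ}
    (hψ : IsTest U ψ) : Integrable (fun z => f z * ψ z.1 - ∑ j, B z j * pd j ψ z.1) μ := by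
  obtain ⟨C, hC⟩ := hψ.exists_bound
  refine Integrable.sub (hf.mul_bdd (c := C) ?_ (Eventually.of_forall fun z => hC z.1))
    (integrable_finsetSum _ fun j _ => ?_)
  · exact (hψ.smooth.continuous.comp continuous_fst).aestronglyMeasurable
  · obtain ⟨C', hC'⟩ := hψ.exists_bound_pd j
    exact (hB j).mul_bdd (c := C') ((hψ.continuous_pd j).comp continuous_fst).aestronglyMeasurable
      (Eventually.of_forall fun z => hC' z.1)

/-- The integral is the L² inner product with a fixed vector. -/
theorem continuousOn_integral_mul {U : ℝ → Lp ℝ 2 ((volume : Measure (E N)).restrict Ω)}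
    {I : Set ℝ} (hU : ContinuousOn U I) {ψ : E N → ℝ} (hψ : MemLp ψ 2 (volume.restrict Ω)) :
    ContinuousOn (fun t => ∫ x in Ω, U t x * ψ x) I := by
  have h : ContinuousOn (fun t => inner ℝ (hψ.toLp ψ) (U t)) I := continuousOn_const.inner hU
  refine h.congr fun t _ => ?_
  change _ = inner ℝ (hψ.toLp ψ) (U t)
  rw [L2.inner_def]
  refine integral_congr_ae ?_
  filter_upwards [hψ.coeFn_toLp] with x hx
  simp [hx]

/-- The weak formulation tested with a function of `x`, integrated in time. -/
theorem integral_time_increment (hΩ : IsOpen Ω) (hΩb : Bornology.IsBounded Ω)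
    {U : ℝ → Lp ℝ 2 (volume.restrict Ω)} (hU : ContinuousOn U (Set.Icc 0 T))
    {u f : E N × ℝ → ℝ} {B : E N × ℝ → E N}
    (hUu : ∀ᵐ t ∂(volume.restrict (Set.Ioo 0 T)), ∀ᵐ x ∂(volume.restrict Ω), U t x = u (x, t))
    (hu : Integrable u (volume.restrict (cyl Ω T))) (hf : Integrable f (volume.restrict (cyl Ω T)))
    (hB : ∀ j, Integrable (fun z => B z j) (volume.restrict (cyl Ω T)))
    (hweak : ∀ φ, IsTest (cyl Ω T) φ →
      (∫ z in cyl Ω T, ∑ j, B z j * pdx j φ z) - (∫ z in cyl Ω T, u z * pdt φ z)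
        = ∫ z in cyl Ω T, f z * φ z)
    {ψ : E N → ℝ} (hψ : IsTest Ω ψ) {s t : ℝ} (hs : 0 < s) (hst : s ≤ t) (ht : t < T) :
    (∫ x in Ω, U t x * ψ x) - (∫ x in Ω, U s x * ψ x) =
      ∫ z in Ω ×ˢ Set.Ioc s t, (f z * ψ z.1 - ∑ j, B z j * pd j ψ z.1) := by
  have hfin := isFiniteMeasure_restrict hΩb
  set m : E N × ℝ → ℝ := fun z => f z * ψ z.1 - ∑ j, B z j * pd j ψ z.1 with hm
  have hmi : Integrable m (volume.restrict (cyl Ω T)) := integrable_density hf hB hψ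
  set q : ℝ → ℝ := fun t => ∫ x in Ω, U t x * ψ x with hq
  have hqc : ContinuousOn q (Set.Icc 0 T) := continuousOn_integral_mul hU hψ.memLp
  obtain ⟨C, hC⟩ := hψ.exists_bound
  have huψ : Integrable (fun z : E N × ℝ => u z * ψ z.1) (volume.restrict (cyl Ω T)) :=
    hu.mul_bdd (c := C) (hψ.smooth.continuous.comp continuous_fst).aestronglyMeasurable
      (Eventually.of_forall fun z => hC z.1)
  -- Testing with ψ(x) χ(t) and applying Fubini says that q has weak time derivative ∫ m(x, ·) dx.
  -- The cutoffs inserted for χ below tend to the indicator of (s, t].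
  have key : ∀ χ : ℝ → ℝ, ContDiff ℝ ∞ χ → ∀ a b, 0 < a → b < T →
      Function.support χ ⊆ Set.Icc a b →
      ∫ z in cyl Ω T, m z * χ z.2 = - ∫ τ in Set.Ioo 0 T, q τ * deriv χ τ := by
    intro χ hχ a b ha hb hsup
    have h := hweak _ (hψ.prod hχ hsup ha hb)
    have hχb : ∃ C, ∀ τ, ‖χ τ‖ ≤ C := hχ.continuous.bounded_above_of_compact_support
      (HasCompactSupport.of_support_subset_isCompact isCompact_Icc hsup)
    have hχb' : ∃ C, ∀ τ, ‖deriv χ τ‖ ≤ C :=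
      (hχ.continuous_deriv (by simp)).bounded_above_of_compact_support
        (HasCompactSupport.of_support_subset_isCompact isCompact_Icc hsup).deriv
    obtain ⟨c, hc⟩ := hχb
    obtain ⟨c', hc'⟩ := hχb'
    simp only [pdx_mul_prod hψ.smooth hχ, pdt_mul_prod hψ.smooth hχ] at h
    have e1 : ∫ z in cyl Ω T, u z * (ψ z.1 * deriv χ z.2) = ∫ τ in Set.Ioo 0 T, q τ * deriv χ τ := by
      have hi : Integrable (fun z : E N × ℝ => u z * ψ z.1 * deriv χ z.2)
          ((volume.restrict Ω).prod (volume.restrict (Set.Ioo 0 T))) := by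
        rw [← restrict_cyl]
        exact huψ.mul_bdd (c := c')
          ((hχ.continuous_deriv (by simp)).comp continuous_snd).aestronglyMeasurable
          (Eventually.of_forall fun z => hc' z.2)
      simp_rw [← mul_assoc]
      rw [restrict_cyl, integral_prod_symm _ hi]
      refine integral_congr_ae ?_
      filter_upwards [hUu] with τ hτ
      rw [integral_mul_const, hq]
      congr 1
      refine integral_congr_ae ?_
      filter_upwards [hτ] with x hx
      rw [hx]
    have e2 : (∫ z in cyl Ω T, f z * (ψ z.1 * χ z.2)) -
        (∫ z in cyl Ω T, ∑ j, B z j * (pd j ψ z.1 * χ z.2)) = ∫ z in cyl Ω T, m z * χ z.2 := by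
      have hχm : AEStronglyMeasurable (fun z : E N × ℝ => χ z.2) (volume.restrict (cyl Ω T)) :=
        (hχ.continuous.comp continuous_snd).aestronglyMeasurable
      rw [← integral_sub]
      · refine integral_congr_ae (Eventually.of_forall fun z => ?_)
        simp only [hm, sub_mul, Finset.sum_mul, mul_assoc]
      · simp_rw [← mul_assoc]
        exact (hf.mul_bdd (c := C) (hψ.smooth.continuous.comp continuous_fst).aestronglyMeasurable
          (Eventually.of_forall fun z => hC z.1)).mul_bdd (c := c) hχm
            (Eventually.of_forall fun z => hc z.2)
      · refine integrable_finsetSum _ fun j _ => ?_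
        obtain ⟨C', hC'⟩ := hψ.exists_bound_pd j
        simp_rw [← mul_assoc]
        exact ((hB j).mul_bdd (c := C')
          ((hψ.continuous_pd j).comp continuous_fst).aestronglyMeasurable
          (Eventually.of_forall fun z => hC' z.1)).mul_bdd (c := c) hχm
            (Eventually.of_forall fun z => hc z.2)
    rw [e1] at h
    rw [← e2]
    linarith
  have hlim1 : Tendsto (fun n => ∫ z in cyl Ω T, m z * timeCutoff s t n z.2) atTop
      (𝓝 (∫ z in Ω ×ˢ Set.Ioc s t, m z)) := by
    have hset : MeasurableSet (Ω ×ˢ Set.Ioc s t) := hΩ.measurableSet.prod measurableSet_Ioc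
    have e : ∫ z in Ω ×ˢ Set.Ioc s t, m z =
        ∫ z in cyl Ω T, m z * (Set.Ioc s t).indicator (fun _ => 1) z.2 := by
      have h1 : ∫ z in Ω ×ˢ Set.Ioc s t, m z =
          ∫ z in cyl Ω T, (Ω ×ˢ Set.Ioc s t).indicator m z := by
        rw [setIntegral_indicator hset, Set.inter_eq_self_of_subset_right (prod_Ioc_subset_cyl hs ht)]
      rw [h1]
      refine setIntegral_congr_fun (measurableSet_cyl hΩ) fun z hz => ?_
      have hz1 : z.1 ∈ Ω := hz.1
      by_cases h : z.2 ∈ Set.Ioc s t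
      · rw [Set.indicator_of_mem (show z ∈ Ω ×ˢ Set.Ioc s t from ⟨hz1, h⟩)]
        simp [h]
      · rw [Set.indicator_of_notMem (fun h' : z ∈ Ω ×ˢ Set.Ioc s t => h h'.2)]
        simp only [Set.indicator_of_notMem h, mul_zero]
    rw [e]
    refine tendsto_integral_of_dominated_convergence (fun z => |m z|) (fun n => ?_) hmi.abs
      (fun n => ?_) ?_
    · exact hmi.1.mul ((timeCutoff_smooth s t n).continuous.comp continuous_snd).aestronglyMeasurable
    · refine Eventually.of_forall fun z => ?_
      rw [Real.norm_eq_abs, abs_mul]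
      exact mul_le_of_le_one_right (abs_nonneg _) (abs_timeCutoff_le _ _ _ _)
    · exact Eventually.of_forall fun z => (tendsto_timeCutoff hst z.2).const_mul _
  have hq' : ∀ r, 0 < r → r < T → Tendsto (fun n : ℕ => ∫ τ in Set.Ioo 0 T, q τ *
      (((n : ℝ) + 1) * deriv Real.smoothTransition (((n : ℝ) + 1) * (τ - r)))) atTop
      (𝓝 (q r)) := by
    intro r hr hrT
    obtain ⟨c, hc⟩ := isCompact_Icc.exists_bound_of_continuousOn hqc
    have hc0 : 0 ≤ c := (norm_nonneg _).trans (hc r ⟨hr.le, hrT.le⟩)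
    have hrm : Set.Ioo 0 T ∈ 𝓝 r := Ioo_mem_nhds hr hrT
    have hev : (Set.Ioo 0 T).indicator q =ᶠ[𝓝 r] q := by
      filter_upwards [hrm] with x hx using Set.indicator_of_mem hx q
    -- The approximation lemma asks for a function bounded on all of ℝ, so q is cut off outside (0,
    -- T); near the interior point r nothing changes.
    have h := tendsto_integral_approx_right (q := (Set.Ioo 0 T).indicator q) (C := c) (s := r)
      ((aestronglyMeasurable_indicator_iff measurableSet_Ioo).2
        ((hqc.mono Set.Ioo_subset_Icc_self).aestronglyMeasurable measurableSet_Ioo)) (fun τ => ?_) ?_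
    · rw [Set.indicator_of_mem (show r ∈ Set.Ioo 0 T from ⟨hr, hrT⟩)] at h
      refine h.congr fun n => ?_
      rw [← integral_indicator measurableSet_Ioo]
      refine integral_congr_ae (Eventually.of_forall fun τ => ?_)
      by_cases hτ : τ ∈ Set.Ioo 0 T
      · simp only [Set.indicator_of_mem hτ]
      · simp only [Set.indicator_of_notMem hτ, zero_mul]
    · by_cases hτ : τ ∈ Set.Ioo 0 T
      · rw [Set.indicator_of_mem hτ]; exact hc τ (Set.Ioo_subset_Icc_self hτ)
      · rw [Set.indicator_of_notMem hτ, abs_zero]; exact hc0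
    · have : ContinuousAt q r := hqc.continuousAt (Icc_mem_nhds hr hrT)
      exact this.congr_of_eventuallyEq hev
  -- The derivative of the cutoff is an approximate delta at s minus one at t.
  have hlim2 : Tendsto (fun n => - ∫ τ in Set.Ioo 0 T, q τ * deriv (timeCutoff s t n) τ) atTop
      (𝓝 (- (q s - q t))) := by
    refine (((hq' s hs (hst.trans_lt ht)).sub (hq' t (hs.trans_le hst) ht)).congr fun n => ?_).neg
    have hi : ∀ r, Integrable (fun τ => q τ *
        (((n : ℝ) + 1) * deriv Real.smoothTransition (((n : ℝ) + 1) * (τ - r))))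
        (volume.restrict (Set.Ioo 0 T)) := by
      intro r
      refine IntegrableOn.mono_set (t := Set.Icc 0 T) ?_ Set.Ioo_subset_Icc_self
      refine ContinuousOn.integrableOn_compact isCompact_Icc (hqc.mul ?_)
      have := continuous_deriv_smoothTransition
      fun_prop
    rw [← integral_sub (hi s) (hi t)]
    refine integral_congr_ae (Eventually.of_forall fun τ => ?_)
    simp only [deriv_timeCutoff]
    ring
  have hev : ∀ᶠ n : ℕ in atTop, ∫ z in cyl Ω T, m z * timeCutoff s t n z.2 =
      - ∫ τ in Set.Ioo 0 T, q τ * deriv (timeCutoff s t n) τ := by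
    -- The support of the cutoff reaches up to t + 1/(n+1), which must stay below T.
    filter_upwards [(tendsto_one_div_add_atTop_nhds_zero_nat (𝕜 := ℝ)).eventually
      (gt_mem_nhds (sub_pos.2 ht))] with n hn
    exact key _ (timeCutoff_smooth s t n) s (t + 1 / ((n : ℝ) + 1)) hs (by linarith)
      (support_timeCutoff hst n)
  have := tendsto_nhds_unique (hlim1.congr' hev) hlim2
  rw [this]
  ring

end Aniso

/-! ### Convexity of the primitive and the inequality for one time step. -/

namespace Aniso

/-- The primitive of `H` that vanishes at `0`. -/
noncomputable def primitive (H : ℝ → ℝ) (s : ℝ) : ℝ := ∫ r in (0 : ℝ)..s, H r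

namespace IsCutoff

variable {H : ℝ → ℝ} {M : ℝ} (h : IsCutoff H M)
include h

theorem primitive_sub (a b : ℝ) : primitive H b - primitive H a = ∫ r in a..b, H r :=
  intervalIntegral.integral_interval_sub_left (h.continuous.intervalIntegrable _ _)
    (h.continuous.intervalIntegrable _ _)

/-- Since H is monotone its primitive is convex and lies above its tangent at b. The slope is taken
at b, so b has to be the later time when H(w) is evaluated there. -/
theorem primitive_sub_le (a b : ℝ) : primitive H b - primitive H a ≤ (b - a) * H b := by
  rw [h.primitive_sub]
  rcases le_total a b with hab | hab
  · calc ∫ r in a..b, H r ≤ ∫ _ in a..b, H b :=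
          intervalIntegral.integral_mono_on hab (h.continuous.intervalIntegrable _ _)
            (by simp) fun x hx => h.mono hx.2
      _ = (b - a) * H b := by simp
  · have : ∫ _ in b..a, H b ≤ ∫ r in b..a, H r :=
      intervalIntegral.integral_mono_on hab (by simp) (h.continuous.intervalIntegrable _ _)
        fun x hx => h.mono hx.1
    rw [intervalIntegral.integral_symm]
    simp only [intervalIntegral.integral_const, smul_eq_mul] at this
    linarith

theorem lipschitz_primitive : LipschitzWith 1 (primitive H) := by
  refine LipschitzWith.of_dist_le_mul fun a b => ?_
  rw [dist_comm, Real.dist_eq, h.primitive_sub, NNReal.coe_one, one_mul, dist_comm, Real.dist_eq]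
  have := intervalIntegral.norm_integral_le_of_norm_le_const (a := a) (b := b) (f := H) (C := 1)
    fun x _ => h.abs_le_one x
  rwa [one_mul] at this

theorem primitive_zero : primitive H 0 = 0 := by simp [primitive]

theorem primitive_eq_zero {s : ℝ} (hs : s ≤ 0) : primitive H s = 0 := by
  rw [primitive, intervalIntegral.integral_congr (g := fun _ => 0)]
  · simp
  · intro x hx
    rw [Set.uIcc_of_ge hs] at hx
    exact h.zero x hx.2

theorem primitive_nonneg (s : ℝ) : 0 ≤ primitive H s := by
  rcases le_total s 0 with hs | hs
  · rw [h.primitive_eq_zero hs]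
  · exact intervalIntegral.integral_nonneg hs fun x _ => h.nonneg x

end IsCutoff

variable {N : ℕ} {Ω : Set (E N)} {T : ℝ}

theorem tendsto_eLpNorm_comp_fst {ι : Type*} {l : Filter ι} {α β : Type*} [MeasurableSpace α]
    [MeasurableSpace β] {μ : Measure α} {ν : Measure β} [IsFiniteMeasure ν] {p : ℝ≥0∞}
    (hp' : p ≠ ⊤) {f : ι → α → ℝ} (hf : ∀ i, AEStronglyMeasurable (f i) μ)
    (h : Tendsto (fun i => eLpNorm (f i) p μ) l (𝓝 0)) :
    Tendsto (fun i => eLpNorm (fun z : α × β => f i z.1) p (μ.prod ν)) l (𝓝 0) := by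
  simp_rw [fun i => eLpNorm_comp_fst (ν := ν) hp' (hf i)]
  have := ENNReal.Tendsto.const_mul (a := (ν Set.univ) ^ (1 / p.toReal)) h
    (Or.inr (ENNReal.rpow_ne_top_of_nonneg (by positivity) (measure_ne_top _ _)))
  simpa using this

/-- The test function H(w), with w the slice at the end of the step, does not depend on time, so it
is reached in `hid` as a limit of test functions in x. The source term is dropped because F ≤ 0 ≤ H,
and convexity bounds the increment of the primitive by (W₂ - W₁) H(W₂). -/
theorem integral_primitive_sub_le (hΩ : IsOpen Ω) (hΩb : Bornology.IsBounded Ω) {p q : Fin N → ℝ}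
    (hpq : ∀ j, (p j).HolderConjugate (q j)) {W₁ W₂ : Lp ℝ 2 (volume.restrict Ω)} {s t : ℝ}
    {F : E N × ℝ → ℝ} {B : E N × ℝ → E N}
    (hF : MemLp F 2 (volume.restrict (Ω ×ˢ Set.Ioc s t)))
    (hF0 : ∀ᵐ z ∂(volume.restrict (Ω ×ˢ Set.Ioc s t)), F z ≤ 0)
    (hB : ∀ j, MemLp (fun z => B z j) (ENNReal.ofReal (q j)) (volume.restrict (Ω ×ˢ Set.Ioc s t)))
    (hid : ∀ ψ, IsTest Ω ψ → (∫ x in Ω, W₂ x * ψ x) - (∫ x in Ω, W₁ x * ψ x) =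
      ∫ z in Ω ×ˢ Set.Ioc s t, (F z * ψ z.1 - ∑ j, B z j * pd j ψ z.1))
    {w η : E N → ℝ} {Dw Dη : E N → E N} (hWw : ∀ᵐ x ∂(volume.restrict Ω), W₂ x = w x)
    (hη : IsW1p0 Ω p η Dη) (hw : IsW11 Ω w Dw)
    (hwp : ∀ j, MemLp (fun x => Dw x j) (ENNReal.ofReal (p j)) (volume.restrict Ω))
    (hle : ∀ᵐ x ∂(volume.restrict Ω), w x ≤ η x) {H : ℝ → ℝ} {M : ℝ} (hH : IsCutoff H M) :
    (∫ x in Ω, primitive H (W₂ x)) - (∫ x in Ω, primitive H (W₁ x)) ≤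
      - ∑ j, ∫ z in Ω ×ˢ Set.Ioc s t, B z j * (deriv H (w z.1) * Dw z.1 j) := by
  have hfin := isFiniteMeasure_restrict hΩb
  have hprod : (volume : Measure (E N × ℝ)).restrict (Ω ×ˢ Set.Ioc s t) =
      (volume.restrict Ω).prod (volume.restrict (Set.Ioc s t)) := by
    rw [Measure.prod_restrict]; rfl
  obtain ⟨ψ, hψ, hψ2, hψp⟩ := exists_test_approx hΩ hΩb (fun j => (hpq j).lt) hη hw hwp hle hH
  have hwm := hw.integrable.1
  have hHw : MemLp (fun x => H (w x)) 2 (volume.restrict Ω) :=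
    MemLp.of_bound (hH.continuous.comp_aestronglyMeasurable hwm) 1
      (Eventually.of_forall fun x => hH.abs_le_one _)
  have hDw : ∀ j, MemLp (fun x => deriv H (w x) * Dw x j) (ENNReal.ofReal (p j))
      (volume.restrict Ω) := fun j =>
    (hwp j).of_le_mul (c := M) ((hH.continuous_deriv.comp_aestronglyMeasurable hwm).mul (hwp j).1)
      (Eventually.of_forall fun x => by
        rw [norm_mul]
        exact mul_le_mul_of_nonneg_right (hH.deriv_le _) (norm_nonneg _))
  have h2 : (1 : ℝ≥0∞) ≤ 2 := by norm_num
  have hp1 : ∀ j, 1 ≤ ENNReal.ofReal (p j) := fun j => one_le_ofReal (hpq j).lt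
  have hhold : ∀ j, ENNReal.HolderTriple (ENNReal.ofReal (q j)) (ENNReal.ofReal (p j)) 1 := fun j =>
    (hpq j).symm.ennrealOfReal
  have l1 : ∀ W : Lp ℝ 2 (volume.restrict Ω), Tendsto (fun n => ∫ x in Ω, W x * ψ n x) atTop
      (𝓝 (∫ x in Ω, W x * H (w x))) := fun W =>
    tendsto_integral_mul_of_tendsto_eLpNorm (p := 2) (q := 2) h2
      (Eventually.of_forall fun _ => Lp.memLp W) (Lp.memLp W)
      (Eventually.of_forall fun n => (hψ n).memLp) hHw (by simp) hψ2
  have l2 : Tendsto (fun n => ∫ z in Ω ×ˢ Set.Ioc s t, F z * ψ n z.1) atTop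
      (𝓝 (∫ z in Ω ×ˢ Set.Ioc s t, F z * H (w z.1))) := by
    rw [hprod] at hF ⊢
    refine tendsto_integral_mul_of_tendsto_eLpNorm (p := 2) (q := 2) h2
      (Eventually.of_forall fun _ => hF) hF
      (Eventually.of_forall fun n => (hψ n).memLp.comp_fst _) (hHw.comp_fst _) (by simp) ?_
    exact tendsto_eLpNorm_comp_fst (f := fun n x => ψ n x - H (w x)) (by simp)
      (fun n => (hψ n).smooth.continuous.aestronglyMeasurable.sub hHw.1) hψ2
  have l3 : ∀ j, Tendsto (fun n => ∫ z in Ω ×ˢ Set.Ioc s t, B z j * pd j (ψ n) z.1) atTop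
      (𝓝 (∫ z in Ω ×ˢ Set.Ioc s t, B z j * (deriv H (w z.1) * Dw z.1 j))) := by
    intro j
    have hBj := hB j
    rw [hprod] at hBj ⊢
    refine tendsto_integral_mul_of_tendsto_eLpNorm (hpq := hhold j) (hp1 j)
      (Eventually.of_forall fun _ => hBj) hBj
      (Eventually.of_forall fun n => ((hψ n).memLp_pd j).comp_fst _) ((hDw j).comp_fst _) (by simp) ?_
    exact tendsto_eLpNorm_comp_fst (f := fun n x => pd j (ψ n) x - deriv H (w x) * Dw x j) (by simp)
      (fun n => ((hψ n).continuous_pd j).aestronglyMeasurable.sub (hDw j).1) (hψp j)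
  have hid' : (∫ x in Ω, W₂ x * H (w x)) - (∫ x in Ω, W₁ x * H (w x)) =
      (∫ z in Ω ×ˢ Set.Ioc s t, F z * H (w z.1)) -
        ∑ j, ∫ z in Ω ×ˢ Set.Ioc s t, B z j * (deriv H (w z.1) * Dw z.1 j) := by
    refine tendsto_nhds_unique ((l1 W₂).sub (l1 W₁)) ?_
    refine (l2.sub (tendsto_finsetSum _ fun j _ => l3 j)).congr fun n => ?_
    rw [hid _ (hψ n), integral_sub, integral_finsetSum]
    · intro j _
      refine memLp_one_iff_integrable.1 (MemLp.mul' (hpqr := hhold j) ?_ (hB j))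
      rw [hprod]; exact ((hψ n).memLp_pd j).comp_fst _
    · refine memLp_one_iff_integrable.1 (MemLp.mul' (p := 2) (q := 2) ?_ hF)
      rw [hprod]; exact (hψ n).memLp.comp_fst _
    · refine integrable_finsetSum _ fun j _ => ?_
      refine memLp_one_iff_integrable.1 (MemLp.mul' (hpqr := hhold j) ?_ (hB j))
      rw [hprod]; exact ((hψ n).memLp_pd j).comp_fst _
  have hFH : ∫ z in Ω ×ˢ Set.Ioc s t, F z * H (w z.1) ≤ 0 := by
    refine integral_nonpos_of_ae ?_
    filter_upwards [hF0] with z hz using mul_nonpos_of_nonpos_of_nonneg hz (hH.nonneg _)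
  have hG : ∀ W : Lp ℝ 2 (volume.restrict Ω), Integrable (fun x => primitive H (W x))
      (volume.restrict Ω) := fun W => by
    have hW : MemLp W 1 (volume.restrict Ω) := (Lp.memLp W).mono_exponent h2
    refine (memLp_one_iff_integrable.1 hW).mono
      (hH.lipschitz_primitive.continuous.comp_aestronglyMeasurable hW.1)
      (Eventually.of_forall fun x => ?_)
    have := hH.lipschitz_primitive.dist_le_mul (W x) 0
    rw [hH.primitive_zero] at this
    simpa using this
  have hWH : ∀ W : Lp ℝ 2 (volume.restrict Ω), Integrable (fun x => W x * H (w x))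
      (volume.restrict Ω) := fun W =>
    memLp_one_iff_integrable.1 (MemLp.mul' (p := 2) (q := 2) hHw (Lp.memLp W))
  have hconv : (∫ x in Ω, primitive H (W₂ x)) - (∫ x in Ω, primitive H (W₁ x)) ≤
      (∫ x in Ω, W₂ x * H (w x)) - (∫ x in Ω, W₁ x * H (w x)) := by
    rw [← integral_sub (hG _) (hG _), ← integral_sub (hWH _) (hWH _)]
    refine integral_mono_ae ((hG _).sub (hG _)) ((hWH _).sub (hWH _)) ?_
    filter_upwards [hWw] with x hx
    have := hH.primitive_sub_le (W₁ x) (W₂ x)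
    rw [← hx]
    linarith
  linarith

end Aniso

/-! ### Steklov averages and the energy inequality. -/

namespace Aniso

variable {N : ℕ} {Ω : Set (E N)} {T : ℝ}

instance : (volume : Measure (E N × ℝ)).IsAddHaarMeasure :=
  Measure.prod.instIsAddHaarMeasure _ _

/-- The uniform probability measure on `{0} × (0, h]`. -/
noncomputable def steklovMeasure (N : ℕ) (h : ℝ) : Measure (E N × ℝ) :=
  ((ENNReal.ofReal h)⁻¹ • (volume : Measure ℝ).restrict (Set.Ioc 0 h)).map fun σ => (0, σ)

theorem measurable_zero_prodMk : Measurable fun σ : ℝ => ((0 : E N), σ) := by fun_prop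

theorem isProbabilityMeasure_steklovMeasure {h : ℝ} (hh : 0 < h) :
    IsProbabilityMeasure (steklovMeasure N h) := by
  refine ⟨?_⟩
  rw [steklovMeasure, Measure.map_apply measurable_zero_prodMk MeasurableSet.univ]
  have : ENNReal.ofReal h ≠ 0 := by simpa using hh
  simp [ENNReal.inv_mul_cancel this ENNReal.ofReal_ne_top]

theorem avg_steklovMeasure {h : ℝ} (hh : 0 < h) (g : E N × ℝ → ℝ) (x : E N) (t : ℝ) :
    avg (steklovMeasure N h) g (x, t) = h⁻¹ * ∫ τ in Set.Ioc t (t + h), g (x, τ) := by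
  have hemb : MeasurableEmbedding fun σ : ℝ => ((0 : E N), σ) := measurableEmbedding_prodMk_left 0
  rw [avg, steklovMeasure, hemb.integral_map, integral_smul_measure, ENNReal.toReal_inv,
    ENNReal.toReal_ofReal hh.le, smul_eq_mul]
  congr 1
  rw [← intervalIntegral.integral_of_le hh.le, ← intervalIntegral.integral_of_le (by linarith)]
  have := intervalIntegral.integral_comp_add_left (a := 0) (b := h) (fun τ => g (x, τ)) t
  rw [add_zero] at this
  rw [← this]
  simp

theorem tendsto_eLpNorm_steklov_sub {p : ℝ≥0∞} (hp : 1 ≤ p) (hp' : p ≠ ⊤) {g : E N × ℝ → ℝ}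
    (hg : MemLp g p) :
    Tendsto (fun h => eLpNorm (fun z => avg (steklovMeasure N h) g z - g z) p volume)
      (𝓝[>] 0) (𝓝 0) := by
  refine tendsto_eLpNorm_avg_sub hp hp' hg ?_ ?_
  · filter_upwards [self_mem_nhdsWithin] with h hh using isProbabilityMeasure_steklovMeasure hh
  · intro U hU
    obtain ⟨ε, hε, hb⟩ := Metric.mem_nhds_iff.1 hU
    filter_upwards [self_mem_nhdsWithin, mem_nhdsWithin_of_mem_nhds (Iio_mem_nhds hε)] with h hh hhε
    have hball : ∀ᵐ y ∂(steklovMeasure N h), y ∈ Metric.ball (0 : E N × ℝ) ε := by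
      rw [steklovMeasure]
      refine (ae_map_iff (p := fun y => y ∈ Metric.ball (0 : E N × ℝ) ε)
        measurable_zero_prodMk.aemeasurable Metric.isOpen_ball.measurableSet).2 ?_
      refine Measure.ae_smul_measure ?_ _
      filter_upwards [ae_restrict_mem measurableSet_Ioc] with σ hσ
      rw [Metric.mem_ball, dist_zero_right, Prod.norm_def]
      simp only [norm_zero, Real.norm_eq_abs, abs_of_pos hσ.1]
      exact max_lt hε (hσ.2.trans_lt hhε)
    filter_upwards [hball] with y hy using hb hy

theorem tendsto_eLpNorm_time_translate_sub {p : ℝ≥0∞} (hp : 1 ≤ p) (hp' : p ≠ ⊤)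
    {g : E N × ℝ → ℝ} (hg : MemLp g p) :
    Tendsto (fun h : ℝ => eLpNorm (fun z => g (z + (0, h)) - g z) p volume) (𝓝[>] 0) (𝓝 0) := by
  refine (tendsto_eLpNorm_translate_sub hp hp' hg).comp ?_
  have : Tendsto (fun h : ℝ => ((0 : E N), h)) (𝓝 0) (𝓝 (0, 0)) :=
    (Continuous.prodMk_right (0 : E N)).tendsto 0
  exact this.mono_left nhdsWithin_le_nhds

/-- The difference of integrals telescopes to the integral over (t, t+h) minus that over (s, s+h);
divided by h, these are difference quotients of a primitive of g. -/
theorem tendsto_difference_quotient_integral {g : ℝ → ℝ} (hg : Continuous g) (s t : ℝ) :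
    Tendsto (fun h => h⁻¹ * ((∫ τ in s..t, g (τ + h)) - ∫ τ in s..t, g τ)) (𝓝[>] 0)
      (𝓝 (g t - g s)) := by
  have hd : ∀ t, HasDerivAt (fun t => ∫ τ in (0 : ℝ)..t, g τ) (g t) t := fun t =>
    intervalIntegral.integral_hasDerivAt_right (hg.intervalIntegrable _ _)
      (hg.stronglyMeasurableAtFilter _ _) hg.continuousAt
  have h1 := fun t => (hasDerivAt_iff_tendsto_slope_zero.1 (hd t))
  refine (((h1 t).sub (h1 s)).mono_left (nhdsWithin_mono _ fun x hx => ne_of_gt hx)).congr fun h => ?_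
  have hi : ∀ a b, IntervalIntegrable g volume a b := fun a b => hg.intervalIntegrable _ _
  rw [intervalIntegral.integral_comp_add_right, ← smul_sub, smul_eq_mul]
  congr 1
  have e1 := intervalIntegral.integral_add_adjacent_intervals (hi 0 (s + h)) (hi (s + h) (t + h))
  have e2 := intervalIntegral.integral_add_adjacent_intervals (hi 0 s) (hi s t)
  linarith

/-- The primitive is 1-Lipschitz and vanishes at 0, so composition with it is continuous on L²; the
integral pairs the result with the constant 1. -/
theorem continuousOn_integral_primitive (hΩb : Bornology.IsBounded Ω)
    {W : ℝ → Lp ℝ 2 ((volume : Measure (E N)).restrict Ω)} {I : Set ℝ}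
    (hW : ContinuousOn W I) {H : ℝ → ℝ} {M : ℝ} (hH : IsCutoff H M) :
    ContinuousOn (fun t => ∫ x in Ω, primitive H (W t x)) I := by
  have hfin := isFiniteMeasure_restrict hΩb
  have hc : ContinuousOn (fun t => hH.lipschitz_primitive.compLp hH.primitive_zero (W t)) I :=
    (hH.lipschitz_primitive.continuous_compLp hH.primitive_zero).comp_continuousOn hW
  refine (continuousOn_integral_mul hc (memLp_const 1)).congr fun t _ => ?_
  refine integral_congr_ae ?_
  filter_upwards [hH.lipschitz_primitive.coeFn_compLp hH.primitive_zero (W t)] with x hx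
  simp [hx]

/-- The energy inequality obtained by testing with `H(w)`. -/
theorem energy_le (hΩ : IsOpen Ω) (hΩb : Bornology.IsBounded Ω) {p q : Fin N → ℝ}
    (hpq : ∀ j, (p j).HolderConjugate (q j)) {W : ℝ → Lp ℝ 2 (volume.restrict Ω)}
    (hW : ContinuousOn W (Set.Icc 0 T)) {w F : E N × ℝ → ℝ} {B Dw : E N × ℝ → E N}
    (hWw : ∀ᵐ t ∂(volume.restrict (Set.Ioo 0 T)), ∀ᵐ x ∂(volume.restrict Ω), W t x = w (x, t))
    (hw : AEStronglyMeasurable w (volume.restrict (cyl Ω T)))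
    (hF : MemLp F 2 (volume.restrict (cyl Ω T)))
    (hF0 : ∀ᵐ z ∂(volume.restrict (cyl Ω T)), F z ≤ 0)
    (hB : ∀ j, MemLp (fun z => B z j) (ENNReal.ofReal (q j)) (volume.restrict (cyl Ω T)))
    (hDw : ∀ j, MemLp (fun z => Dw z j) (ENNReal.ofReal (p j)) (volume.restrict (cyl Ω T)))
    (hslice : ∀ᵐ t ∂(volume.restrict (Set.Ioo 0 T)),
      IsW11 Ω (fun x => w (x, t)) (fun x => Dw (x, t)) ∧
        ∃ η Dη, IsW1p0 Ω p η Dη ∧ ∀ᵐ x ∂(volume.restrict Ω), w (x, t) ≤ η x)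
    (hid : ∀ ψ, IsTest Ω ψ → ∀ s t, 0 < s → s ≤ t → t < T →
      (∫ x in Ω, W t x * ψ x) - (∫ x in Ω, W s x * ψ x) =
        ∫ z in Ω ×ˢ Set.Ioc s t, (F z * ψ z.1 - ∑ j, B z j * pd j ψ z.1))
    {H : ℝ → ℝ} {M : ℝ} (hH : IsCutoff H M) {s t : ℝ} (hs : 0 < s) (hst : s ≤ t) (ht : t < T) :
    (∫ x in Ω, primitive H (W t x)) - (∫ x in Ω, primitive H (W s x)) ≤
      - ∑ j, ∫ z in Ω ×ˢ Set.Ioc s t, B z j * (deriv H (w z) * Dw z j) := by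
  have hfin := isFiniteMeasure_restrict hΩb
  have hT : 0 ≤ T := (hs.trans_le (hst.trans ht.le)).le
  have hcm : MeasurableSet (cyl Ω T) := measurableSet_cyl hΩ
  have hp1 : ∀ j, 1 ≤ ENNReal.ofReal (p j) := fun j => one_le_ofReal (hpq j).lt
  have hq1 : ∀ j, 1 ≤ ENNReal.ofReal (q j) := fun j => one_le_ofReal (hpq j).symm.lt
  have hhold : ∀ j, ENNReal.HolderTriple (ENNReal.ofReal (q j)) (ENNReal.ofReal (p j)) 1 := fun j =>
    (hpq j).symm.ennrealOfReal
  have hprod : ∀ a b : ℝ, (volume : Measure (E N × ℝ)).restrict (Ω ×ˢ Set.Ioc a b) =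
      (volume.restrict Ω).prod (volume.restrict (Set.Ioc a b)) := fun a b => by
    rw [Measure.prod_restrict]; rfl
  set B' : Fin N → E N × ℝ → ℝ := fun j => (cyl Ω T).indicator fun z => B z j with hB'
  -- Flux and test gradient are extended by zero so that averaging and translating in time make
  -- sense on the whole space.
  set ζ : Fin N → E N × ℝ → ℝ := fun j => (cyl Ω T).indicator fun z => deriv H (w z) * Dw z j with hζ
  have hB'L : ∀ j, MemLp (B' j) (ENNReal.ofReal (q j)) := fun j =>
    (memLp_indicator_iff_restrict hcm).2 (hB j)
  have hζL : ∀ j, MemLp (ζ j) (ENNReal.ofReal (p j)) := fun j =>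
    (memLp_indicator_iff_restrict hcm).2 ((hDw j).of_le_mul (c := M)
      ((hH.continuous_deriv.comp_aestronglyMeasurable hw).mul (hDw j).1)
      (Eventually.of_forall fun x => by
        rw [norm_mul]
        exact mul_le_mul_of_nonneg_right (hH.deriv_le _) (norm_nonneg _)))
  have hmp : ∀ h : ℝ, MeasurePreserving (fun z : E N × ℝ => z + (0, h)) volume volume := fun h =>
    measurePreserving_add_right volume _
  have hζh : ∀ j h, MemLp (fun z => ζ j (z + (0, h))) (ENNReal.ofReal (p j)) := fun j h =>
    (hζL j).comp_measurePreserving (hmp h)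
  have havg : ∀ j {h : ℝ}, 0 < h →
      MemLp (avg (steklovMeasure N h) (B' j)) (ENNReal.ofReal (q j)) := fun j h hh => by
    have := isProbabilityMeasure_steklovMeasure (N := N) hh
    exact memLp_avg (hq1 j) (by simp) (hB'L j)
  set g₀ : ℝ → ℝ := fun t => ∫ x in Ω, primitive H (W t x) with hg₀
  have hg₀c : ContinuousOn g₀ (Set.Icc 0 T) := continuousOn_integral_primitive hΩb hW hH
  -- Constant extension beyond [0, T] gives a function continuous on ℝ; for h < T - t only times in
  -- [0, T] are used.
  set g : ℝ → ℝ := Set.IccExtend hT ((Set.Icc 0 T).domRestrict g₀) with hg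
  have hgc : Continuous g := (continuousOn_iff_continuous_domRestrict.1 hg₀c).Icc_extend'
  have hgg : ∀ τ ∈ Set.Icc 0 T, g τ = g₀ τ := fun τ hτ => by
    rw [hg, Set.IccExtend_of_mem hT _ hτ]; rfl
  have hslice' : ∀ᵐ t ∂(volume : Measure ℝ), t ∈ Set.Ioo 0 T →
      (∀ᵐ x ∂(volume.restrict Ω), W t x = w (x, t)) ∧
      (IsW11 Ω (fun x => w (x, t)) (fun x => Dw (x, t)) ∧
        ∃ η Dη, IsW1p0 Ω p η Dη ∧ ∀ᵐ x ∂(volume.restrict Ω), w (x, t) ≤ η x) ∧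
      ∀ j, MemLp (fun x => Dw (x, t) j) (ENNReal.ofReal (p j)) (volume.restrict Ω) := by
    rw [← ae_restrict_iff' measurableSet_Ioo]
    have h3 : ∀ j, ∀ᵐ t ∂(volume.restrict (Set.Ioo 0 T)),
        MemLp (fun x => Dw (x, t) j) (ENNReal.ofReal (p j)) (volume.restrict Ω) := fun j => by
      have := hDw j
      rw [restrict_cyl] at this
      exact MemLp.ae_prodMk_right (zero_lt_one.trans_le (hp1 j)).ne' (by simp) this
    filter_upwards [hWw, hslice, eventually_all.2 h3] with t h1 h2 h3 using ⟨h1, h2, h3⟩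
  have hstep : ∀ h : ℝ, 0 < h → h < T - t →
      h⁻¹ * ((∫ τ in s..t, g (τ + h)) - ∫ τ in s..t, g τ) ≤
        - ∑ j, ∫ z in Ω ×ˢ Set.Ioc s t, avg (steklovMeasure N h) (B' j) z * ζ j (z + (0, h)) := by
    intro h hh hhT
    have hI : ∀ j, Integrable (fun z => avg (steklovMeasure N h) (B' j) z * ζ j (z + (0, h)))
        ((volume.restrict Ω).prod (volume.restrict (Set.Ioc s t))) := fun j => by
      rw [← hprod]
      exact (memLp_one_iff_integrable.1
        (MemLp.mul' (hpqr := hhold j) (hζh j h) (havg j hh))).restrict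
    have hpt : ∀ᵐ τ ∂(volume.restrict (Set.Ioc s t)), h⁻¹ * (g (τ + h) - g τ) ≤
        - ∑ j, ∫ x in Ω, avg (steklovMeasure N h) (B' j) (x, τ) * ζ j ((x, τ) + (0, h)) := by
      -- The slice properties are needed at time τ + h; translation sends null sets of times to null
      -- sets.
      have hsl := (measurePreserving_add_right volume h).quasiMeasurePreserving.ae hslice'
      filter_upwards [ae_restrict_mem measurableSet_Ioc, ae_restrict_of_ae hsl] with τ hτ hτ2
      have hτ0 : 0 < τ := hs.trans hτ.1
      have hτT : τ + h < T := by linarith [hτ.2]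
      obtain ⟨a1, ⟨a2, η, Dη, a3, a4⟩, a5⟩ := hτ2 ⟨by linarith, hτT⟩
      have hsub : Ω ×ˢ Set.Ioc τ (τ + h) ⊆ cyl Ω T := prod_Ioc_subset_cyl hτ0 hτT
      have hmono : (volume : Measure (E N × ℝ)).restrict (Ω ×ˢ Set.Ioc τ (τ + h)) ≤
        volume.restrict (cyl Ω T) := Measure.restrict_mono hsub le_rfl
      have key := integral_primitive_sub_le hΩ hΩb hpq (W₁ := W τ) (W₂ := W (τ + h))
        (hF.mono_measure hmono) (ae_mono hmono hF0) (fun j => (hB j).mono_measure hmono)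
        (fun ψ hψ => hid ψ hψ τ (τ + h) hτ0 (by linarith) hτT) a1 a3 a2 a5 a4 hH
      rw [hgg _ ⟨by linarith, hτT.le⟩, hgg _ ⟨hτ0.le, by linarith⟩, inv_mul_le_iff₀ hh]
      refine key.trans (le_of_eq ?_)
      rw [mul_neg, Finset.mul_sum]
      congr 1
      refine Finset.sum_congr rfl fun j _ => ?_
      have hmem : ∀ x ∈ Ω, ((x, τ) : E N × ℝ) + (0, h) ∈ cyl Ω T := fun x hx =>
        ⟨by simpa using hx, by simpa using ⟨by linarith, hτT⟩⟩
      have hζs : MemLp (fun x => deriv H (w (x, τ + h)) * Dw (x, τ + h) j) (ENNReal.ofReal (p j))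
          (volume.restrict Ω) := (a5 j).of_le_mul (c := M)
        ((hH.continuous_deriv.comp_aestronglyMeasurable a2.integrable.1).mul (a5 j).1)
        (Eventually.of_forall fun x => by
          rw [norm_mul]
          exact mul_le_mul_of_nonneg_right (hH.deriv_le _) (norm_nonneg _))
      have hBs := (hB j).mono_measure hmono
      rw [hprod] at hBs ⊢
      -- The test gradient is frozen at time τ + h, so the time integral falls on the flux alone and
      -- equals h times its Steklov average at τ.
      rw [integral_prod _ (memLp_one_iff_integrable.1
        (MemLp.mul' (hpqr := hhold j) (hζs.comp_fst _) hBs)), ← integral_const_mul]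
      refine setIntegral_congr_fun hΩ.measurableSet fun x hx => ?_
      simp only
      rw [integral_mul_const, avg_steklovMeasure hh, ← mul_assoc h, mul_inv_cancel_left₀ hh.ne']
      have e1 : ζ j ((x, τ) + (0, h)) = deriv H (w (x, τ + h)) * Dw (x, τ + h) j := by
        simp only [hζ]
        rw [Set.indicator_of_mem (hmem x hx)]
        simp
      rw [e1]
      congr 1
      refine setIntegral_congr_fun measurableSet_Ioc fun σ hσ => ?_
      simp only [hB']
      rw [Set.indicator_of_mem (hsub ⟨hx, hσ⟩)]
    have hgh : Continuous fun τ => g (τ + h) := by fun_prop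
    rw [← intervalIntegral.integral_sub (hgh.intervalIntegrable _ _)
      (hgc.intervalIntegrable _ _), ← intervalIntegral.integral_const_mul,
      intervalIntegral.integral_of_le hst]
    have e2 : ∑ j, ∫ z in Ω ×ˢ Set.Ioc s t, avg (steklovMeasure N h) (B' j) z * ζ j (z + (0, h)) =
        ∫ τ in Set.Ioc s t, ∑ j, ∫ x in Ω,
          avg (steklovMeasure N h) (B' j) (x, τ) * ζ j ((x, τ) + (0, h)) := by
      rw [integral_finsetSum _ fun j _ => (hI j).integral_prod_right]
      refine Finset.sum_congr rfl fun j _ => ?_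
      rw [hprod, integral_prod_symm _ (hI j)]
    rw [e2, ← integral_neg]
    refine integral_mono_ae ?_ ?_ hpt
    · refine (ContinuousOn.integrableOn_Icc (Continuous.continuousOn ?_)).mono_set
        Set.Ioc_subset_Icc_self
      fun_prop
    · exact (integrable_finsetSum _ fun j _ => (hI j).integral_prod_right).neg
  have hlim : Tendsto (fun h : ℝ => - ∑ j, ∫ z in Ω ×ˢ Set.Ioc s t,
      avg (steklovMeasure N h) (B' j) z * ζ j (z + (0, h))) (𝓝[>] 0)
      (𝓝 (- ∑ j, ∫ z in Ω ×ˢ Set.Ioc s t, B' j z * ζ j z)) := by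
    refine (tendsto_finsetSum _ fun j _ => ?_).neg
    have hle : (volume : Measure (E N × ℝ)).restrict (Ω ×ˢ Set.Ioc s t) ≤ volume :=
      Measure.restrict_le_self
    refine tendsto_integral_mul_of_tendsto_eLpNorm (hpq := hhold j) (hp1 j) ?_
      ((hB'L j).mono_measure hle) (Eventually.of_forall fun h => (hζh j h).mono_measure hle)
      ((hζL j).mono_measure hle) ?_ ?_
    · filter_upwards [self_mem_nhdsWithin] with h hh using (havg j hh).mono_measure hle
    · exact tendsto_of_tendsto_of_tendsto_of_le_of_le tendsto_const_nhds
        (tendsto_eLpNorm_steklov_sub (hq1 j) (by simp) (hB'L j)) (fun _ => zero_le)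
        fun h => eLpNorm_mono_measure _ hle
    · exact tendsto_of_tendsto_of_tendsto_of_le_of_le tendsto_const_nhds
        (tendsto_eLpNorm_time_translate_sub (hp1 j) (by simp) (hζL j)) (fun _ => zero_le)
        fun h => eLpNorm_mono_measure _ hle
  have hfinal := le_of_tendsto_of_tendsto (tendsto_difference_quotient_integral hgc s t) hlim (by
    filter_upwards [self_mem_nhdsWithin,
      mem_nhdsWithin_of_mem_nhds (Iio_mem_nhds (sub_pos.2 ht))] with h hh hhT using hstep h hh hhT)
  rw [hgg t ⟨hs.le.trans hst, ht.le⟩, hgg s ⟨hs.le, hst.trans ht.le⟩] at hfinal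
  refine hfinal.trans (le_of_eq ?_)
  congr 1
  refine Finset.sum_congr rfl fun j _ => ?_
  refine setIntegral_congr_fun (hΩ.measurableSet.prod measurableSet_Ioc) fun z hz => ?_
  have hz' := prod_Ioc_subset_cyl hs ht hz
  simp only [hB', hζ, Set.indicator_of_mem hz']

end Aniso

/-! ### Integrability of the flux, and the closure of test functions under subtraction. -/

namespace Aniso

section Caratheodory

variable {α X Y : Type*} [MeasurableSpace α] {μ : Measure α} [TopologicalSpace X]
  [TopologicalSpace.PseudoMetrizableSpace X] [SecondCountableTopology X] [MeasurableSpace X]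
  [BorelSpace X] [TopologicalSpace Y] [TopologicalSpace.PseudoMetrizableSpace Y] [MeasurableSpace Y]
  [BorelSpace Y]

theorem aemeasurable_comp_simpleFunc {f : α → X → Y} (hf : ∀ x, AEMeasurable (fun a => f a x) μ)
    (s : SimpleFunc α X) : AEMeasurable (fun a => f a (s a)) μ := by
  have hU : (⋃ x : s.range, s ⁻¹' {x.1}) = Set.univ := by
    refine Set.eq_univ_of_forall fun a => Set.mem_iUnion.2 ⟨⟨s a, s.mem_range_self a⟩, rfl⟩
  rw [← Measure.restrict_univ (μ := μ), ← hU, aemeasurable_iUnion_iff]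
  intro x
  refine ((hf x.1).mono_measure Measure.restrict_le_self).congr ?_
  filter_upwards [ae_restrict_mem (s.measurableSet_fiber x.1)] with a ha
  rw [show s a = x.1 from ha]

/-- Approximate g pointwise by simple functions: each composition is measurable piece by piece, and
continuity in the second variable passes to the limit. -/
theorem aemeasurable_comp_of_caratheodory {f : α → X → Y}
    (hf : ∀ x, AEMeasurable (fun a => f a x) μ) (hc : ∀ᵐ a ∂μ, Continuous (f a))
    {g : α → X} (hg : AEMeasurable g μ) : AEMeasurable (fun a => f a (g a)) μ := by
  have hs := hg.measurable_mk.stronglyMeasurable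
  have h : AEMeasurable (fun a => f a (hg.mk g a)) μ := by
    refine aemeasurable_of_tendsto_metrizable_ae atTop
      (fun n => aemeasurable_comp_simpleFunc hf (hs.approx n)) ?_
    filter_upwards [hc] with a ha
    exact (ha.tendsto _).comp (hs.tendsto_approx a)
  refine h.congr ?_
  filter_upwards [hg.ae_eq_mk] with a ha
  rw [← ha]

end Caratheodory

/-- Growth and Lipschitz bounds carry the power (p_j - 1)/p_j, the reciprocal of the conjugate
exponent q of p_j; the q-th power of such a bound is the integrable S itself. -/
theorem memLp_rpow_inv {α : Type*} [MeasurableSpace α] {μ : Measure α} {S : α → ℝ}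
    (hS : Integrable S μ) (hS0 : ∀ᵐ x ∂μ, 0 ≤ S x) {q : ℝ} (hq : 0 < q) :
    MemLp (fun x => S x ^ (1 / q)) (ENNReal.ofReal q) μ := by
  have hm : AEStronglyMeasurable (fun x => S x ^ (1 / q)) μ :=
    (hS.1.aemeasurable.pow_const _).aestronglyMeasurable
  rw [← integrable_norm_rpow_iff hm (by simpa using hq) (by simp)]
  refine hS.congr ?_
  filter_upwards [hS0] with x hx
  rw [ENNReal.toReal_ofReal hq.le, Real.norm_of_nonneg (Real.rpow_nonneg hx _), ← Real.rpow_mul hx,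
    one_div_mul_cancel hq.ne', Real.rpow_one]

variable {N : ℕ} {Ω : Set (E N)} {T : ℝ} {p : Fin N → ℝ}

theorem integrable_sum_rpow {μ : Measure (E N × ℝ)} (hp : ∀ j, 1 < p j) {D : E N × ℝ → E N}
    (hD : ∀ j, MemLp (fun z => D z j) (ENNReal.ofReal (p j)) μ) :
    Integrable (fun z => ∑ k, |D z k| ^ p k) μ := by
  refine integrable_finsetSum _ fun k _ => ?_
  have hpk : 0 < p k := zero_lt_one.trans (hp k)
  have := (hD k).integrable_norm_rpow (by simpa using hpk) (by simp)
  simpa [ENNReal.toReal_ofReal hpk.le] using this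

theorem sum_rpow_nonneg (ξ : E N) : 0 ≤ ∑ k, |ξ k| ^ p k :=
  Finset.sum_nonneg fun _ _ => Real.rpow_nonneg (abs_nonneg _) _

theorem aemeasurable_euclidean {α : Type*} [MeasurableSpace α] {μ : Measure α} {D : α → E N}
    (hD : ∀ j, AEMeasurable (fun z => D z j) μ) : AEMeasurable D μ :=
  (MeasurableEquiv.toLp 2 (Fin N → ℝ)).measurable.comp_aemeasurable (aemeasurable_pi_lambda _ hD)

theorem memLp_flux {A : E N → ℝ → ℝ → E N → E N} (hp : ∀ j, 1 < p j) (hA : IsCaratheodory Ω T A)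
    {Λ : ℝ} {a : E N × ℝ → ℝ} (ha : Integrable a (volume.restrict (cyl Ω T)))
    (ha0 : ∀ᵐ z ∂(volume.restrict (cyl Ω T)), 0 ≤ a z) (hgrowth : Growth Ω T p A Λ a)
    {u : E N × ℝ → ℝ} {D : E N × ℝ → E N} (hu : AEMeasurable u (volume.restrict (cyl Ω T)))
    (hD : ∀ j, MemLp (fun z => D z j) (ENNReal.ofReal (p j)) (volume.restrict (cyl Ω T)))
    (j : Fin N) : MemLp (fun z => A z.1 z.2 (u z) (D z) j) (ENNReal.ofReal (p j).conjExponent)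
      (volume.restrict (cyl Ω T)) := by
  have hDm : AEMeasurable D (volume.restrict (cyl Ω T)) :=
    aemeasurable_euclidean fun j => (hD j).1.aemeasurable
  have hm : AEMeasurable (fun z => A z.1 z.2 (u z) (D z)) (volume.restrict (cyl Ω T)) :=
    aemeasurable_comp_of_caratheodory (f := fun z (q : ℝ × E N) => A z.1 z.2 q.1 q.2)
      (fun q => hA.measurable q.1 q.2) hA.continuous (hu.prodMk hDm)
  have hmj : AEStronglyMeasurable (fun z => A z.1 z.2 (u z) (D z) j) (volume.restrict (cyl Ω T)) :=
    ((EuclideanSpace.proj (𝕜 := ℝ) j).continuous.measurable.comp_aemeasurable hm).aestronglyMeasurable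
  have hS := (integrable_sum_rpow hp hD).add ha
  have hc := Real.HolderConjugate.conjExponent (hp j)
  refine (memLp_rpow_inv hS ?_ hc.symm.pos).of_le_mul (c := Λ) hmj ?_
  · filter_upwards [ha0] with z hz using add_nonneg (sum_rpow_nonneg _) hz
  · filter_upwards [hgrowth, ha0] with z hz hz0
    have h0 : 0 ≤ ∑ k, |D z k| ^ p k + a z := add_nonneg (sum_rpow_nonneg _) hz0
    refine (hz (u z) (D z) j).trans (le_of_eq ?_)
    simp only [Pi.add_apply]
    rw [Real.norm_of_nonneg (Real.rpow_nonneg h0 _), Real.conjExponent, one_div_div]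

theorem IsTest.sub {U : Set (E N)} {φ ψ : E N → ℝ} (hφ : IsTest U φ) (hψ : IsTest U ψ) :
    IsTest U (fun x => φ x - ψ x) where
  smooth := hφ.smooth.sub hψ.smooth
  compact := HasCompactSupport.sub hφ.compact hψ.compact
  support := (tsupport_sub φ ψ).trans (Set.union_subset hφ.support hψ.support)

theorem IsTest.pd_sub {U : Set (E N)} {φ ψ : E N → ℝ} (hφ : IsTest U φ) (hψ : IsTest U ψ)
    (j : Fin N) (x : E N) : pd j (fun x => φ x - ψ x) x = pd j φ x - pd j ψ x := by
  have h : fderiv ℝ (fun x => φ x - ψ x) x = _ :=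
    ((hφ.smooth.differentiable (by simp) x).hasFDerivAt.sub
      (hψ.smooth.differentiable (by simp) x).hasFDerivAt).fderiv
  rw [pd, h]
  rfl

theorem IsW1p0.sub (hp : ∀ j, 1 < p j) {v w : E N → ℝ} {D D' : E N → E N}
    (hv : IsW1p0 Ω p v D) (hw : IsW1p0 Ω p w D') :
    IsW1p0 Ω p (fun x => v x - w x) (fun x => D x - D' x) where
  toIsW11 := hv.toIsW11.sub hw.toIsW11
  memLp_grad j := (hv.memLp_grad j).sub (hw.memLp_grad j)
  closure ε hε := by
    obtain ⟨φ, hφ, h1⟩ := hv.closure (ε / 2) (half_pos hε)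
    obtain ⟨ψ, hψ, h2⟩ := hw.closure (ε / 2) (half_pos hε)
    refine ⟨_, hφ.sub hψ, lt_of_le_of_lt ?_ ((ENNReal.add_lt_add h1 h2).trans_eq ?_)⟩
    · rw [add_add_add_comm, ← Finset.sum_add_distrib]
      refine add_le_add ?_ (Finset.sum_le_sum fun j _ => ?_)
      · have e : (fun x => v x - w x - (φ x - ψ x)) = (fun x => v x - φ x) - fun x => w x - ψ x := by
          ext x; simp only [Pi.sub_apply]; ring
        rw [e]
        exact eLpNorm_sub_le (hv.integrable.1.sub hφ.smooth.continuous.aestronglyMeasurable)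
          (hw.integrable.1.sub hψ.smooth.continuous.aestronglyMeasurable) le_rfl
      · have e : (fun x => (D x - D' x) j - pd j (fun x => φ x - ψ x) x) =
            (fun x => D x j - pd j φ x) - fun x => D' x j - pd j ψ x := by
          ext x; simp only [Pi.sub_apply, hφ.pd_sub hψ, PiLp.sub_apply]; ring
        rw [e]
        exact eLpNorm_sub_le ((hv.memLp_grad j).1.sub (hφ.continuous_pd j).aestronglyMeasurable)
          ((hw.memLp_grad j).1.sub (hψ.continuous_pd j).aestronglyMeasurable) (one_le_ofReal (hp j))
    · rw [← ENNReal.ofReal_add (half_pos hε).le (half_pos hε).le, add_halves]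

/-! ### Smooth approximations of the indicator of (0, ∞). -/

theorem exists_bound_deriv_smoothTransition : ∃ M, ∀ s, |deriv Real.smoothTransition s| ≤ M :=
  continuous_deriv_smoothTransition.bounded_above_of_compact_support
    hasCompactSupport_deriv_smoothTransition

/-- Smooth approximations of the indicator function of `(0, ∞)`. -/
noncomputable def step (n : ℕ) (s : ℝ) : ℝ := Real.smoothTransition (((n : ℝ) + 1) * s)

theorem deriv_step (n : ℕ) (s : ℝ) :
    deriv (step n) s = ((n : ℝ) + 1) * deriv Real.smoothTransition (((n : ℝ) + 1) * s) := by
  have h : HasDerivAt (step n) (deriv Real.smoothTransition (((n : ℝ) + 1) * s) *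
      (((n : ℝ) + 1) * 1)) s :=
    (hasDerivAt_smoothTransition _).comp s ((hasDerivAt_id s).const_mul _)
  rw [h.deriv]; ring

theorem isCutoff_step {M : ℝ} (hM : ∀ s, |deriv Real.smoothTransition s| ≤ M) (n : ℕ) :
    IsCutoff (step n) (((n : ℝ) + 1) * M) where
  smooth := contDiff_smoothTransition.comp (by fun_prop)
  zero s hs := Real.smoothTransition.zero_of_nonpos
    (mul_nonpos_of_nonneg_of_nonpos (by positivity) hs)
  mono a b hab := Real.smoothTransition.monotone (mul_le_mul_of_nonneg_left hab (by positivity))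
  le_one s := Real.smoothTransition.le_one _
  deriv_le s := by
    rw [deriv_step, abs_mul, abs_of_nonneg (by positivity : (0 : ℝ) ≤ (n : ℝ) + 1)]
    exact mul_le_mul_of_nonneg_left (hM _) (by positivity)

/-- The derivative of size n + 1 lives only where 0 ≤ s ≤ 1/(n+1), so the factor |s| absorbs its
growth and the bound is uniform in n. -/
theorem abs_mul_deriv_step_le {M : ℝ} (hM : ∀ s, |deriv Real.smoothTransition s| ≤ M) (n : ℕ)
    (s : ℝ) : |s| * deriv (step n) s ≤ M := by
  have hM0 : 0 ≤ M := (abs_nonneg _).trans (hM 0)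
  have hn : (0 : ℝ) < (n : ℝ) + 1 := by positivity
  rw [deriv_step]
  by_cases h : deriv Real.smoothTransition (((n : ℝ) + 1) * s) = 0
  · rw [h]; simpa using hM0
  · have hy := deriv_smoothTransition_support h
    have hs : 0 ≤ s := nonneg_of_mul_nonneg_right hy.1 hn
    rw [abs_of_nonneg hs, ← mul_assoc, mul_comm s]
    have h1 := hM (((n : ℝ) + 1) * s)
    calc _ ≤ (((n : ℝ) + 1) * s) * M :=
          mul_le_mul_of_nonneg_left ((le_abs_self _).trans h1) hy.1
      _ ≤ 1 * M := mul_le_mul_of_nonneg_right hy.2 hM0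
      _ = M := one_mul M

theorem tendsto_abs_mul_deriv_step (s : ℝ) :
    Tendsto (fun n => |s| * deriv (step n) s) atTop (𝓝 0) := by
  obtain ⟨M, hM⟩ := exists_bound_deriv_smoothTransition
  refine tendsto_const_nhds.congr' ?_
  rcases le_or_gt s 0 with hs | hs
  · exact Eventually.of_forall fun n => by simp [(isCutoff_step hM n).deriv_eq_zero hs]
  · filter_upwards [(tendsto_one_div_add_atTop_nhds_zero_nat (𝕜 := ℝ)).eventually
      (gt_mem_nhds hs)] with n hn
    have hn' : (0 : ℝ) < (n : ℝ) + 1 := by positivity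
    rw [div_lt_iff₀' hn'] at hn
    have : deriv Real.smoothTransition (((n : ℝ) + 1) * s) = 0 := by
      by_contra h
      exact absurd (deriv_smoothTransition_support h).2 (not_le.2 hn)
    rw [deriv_step, this, mul_zero, mul_zero]

/-- The integrand equals 1 beyond 1/(n+1). With nonnegativity of the primitive, this bounds the
positive part of s by the primitive plus 1/(n+1). -/
theorem sub_le_primitive_step (n : ℕ) (s : ℝ) : s - 1 / ((n : ℝ) + 1) ≤ primitive (step n) s := by
  obtain ⟨M, hM⟩ := exists_bound_deriv_smoothTransition
  have hH := isCutoff_step hM n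
  have hn' : (0 : ℝ) < (n : ℝ) + 1 := by positivity
  rcases le_total s (1 / ((n : ℝ) + 1)) with hs | hs
  · exact (sub_nonpos.2 hs).trans (hH.primitive_nonneg s)
  · have h1 := hH.primitive_sub (1 / ((n : ℝ) + 1)) s
    have h2 : ∫ r in (1 / ((n : ℝ) + 1))..s, step n r = ∫ _ in (1 / ((n : ℝ) + 1))..s, (1 : ℝ) := by
      refine intervalIntegral.integral_congr fun r hr => ?_
      rw [Set.uIcc_of_le hs] at hr
      have := hr.1
      rw [div_le_iff₀' hn'] at this
      exact Real.smoothTransition.one_of_one_le this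
    rw [h2, intervalIntegral.integral_const, smul_eq_mul, mul_one] at h1
    linarith [hH.primitive_nonneg (1 / ((n : ℝ) + 1))]

end Aniso

/-! ### Initial values, passage to the positive part, and the flux estimate. -/

namespace Aniso

variable {N : ℕ} {Ω : Set (E N)} {T : ℝ} {p : Fin N → ℝ}

/-- Both functions are the L² limit of U from the right at 0. -/
theorem ae_eq_initial (hT : 0 < T) {U : ℝ → Lp ℝ 2 ((volume : Measure (E N)).restrict Ω)}
    (hU : ContinuousOn U (Set.Icc 0 T)) {u₀ : E N → ℝ} (hu₀ : MemLp u₀ 2 (volume.restrict Ω))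
    (hlim : Tendsto (fun t => eLpNorm (fun x => U t x - u₀ x) 2 (volume.restrict Ω))
      (𝓝[>] 0) (𝓝 0)) : ∀ᵐ x ∂(volume.restrict Ω), U 0 x = u₀ x := by
  have h1 : Tendsto U (𝓝[>] 0) (𝓝 (U 0)) := by
    have := hU 0 ⟨le_rfl, hT.le⟩
    exact this.mono_left (by
      rw [← nhdsWithin_Ioo_eq_nhdsGT hT]
      exact nhdsWithin_mono _ Set.Ioo_subset_Icc_self)
  have h2 : Tendsto U (𝓝[>] 0) (𝓝 (hu₀.toLp u₀)) := by
    rw [tendsto_iff_edist_tendsto_0]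
    refine hlim.congr fun t => ?_
    rw [Lp.edist_def]
    refine eLpNorm_congr_ae ?_
    filter_upwards [hu₀.coeFn_toLp] with x hx
    simp [hx]
  rw [tendsto_nhds_unique h1 h2]
  exact hu₀.coeFn_toLp

theorem ae_cyl_of_ae_ae {P : E N × ℝ → Prop} (hP : MeasurableSet {z | P z})
    (h : ∀ᵐ t ∂(volume.restrict (Set.Ioo 0 T)), ∀ᵐ x ∂(volume.restrict Ω), P (x, t)) :
    ∀ᵐ z ∂(volume.restrict (cyl Ω T)), P z := by
  rw [restrict_cyl, Measure.ae_prod_iff_ae_ae hP]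
  exact (Measure.ae_ae_comm (p := fun x t => P (x, t)) hP).2 h

theorem ae_ae_of_ae_cyl {P : E N × ℝ → Prop} (h : ∀ᵐ z ∂(volume.restrict (cyl Ω T)), P z) :
    ∀ᵐ t ∂(volume.restrict (Set.Ioo 0 T)), ∀ᵐ x ∂(volume.restrict Ω), P (x, t) := by
  rw [restrict_cyl] at h
  exact Measure.ae_ae_of_ae_prod
    (Measure.measurePreserving_swap.quasiMeasurePreserving.ae h)

/-- A family of functions satisfying the energy inequality with errors tending to `0` and with
nonpositive initial values is nonpositive. -/
theorem ae_nonpos_of_energy (hΩb : Bornology.IsBounded Ω)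
    {W : ℝ → Lp ℝ 2 ((volume : Measure (E N)).restrict Ω)} (hW : ContinuousOn W (Set.Icc 0 T))
    (hW0 : ∀ᵐ x ∂(volume.restrict Ω), W 0 x ≤ 0) {ε : ℕ → ℝ} (hε : Tendsto ε atTop (𝓝 0))
    (hen : ∀ n s t, 0 < s → s ≤ t → t < T →
      (∫ x in Ω, primitive (step n) (W t x)) - (∫ x in Ω, primitive (step n) (W s x)) ≤ ε n)
    {t : ℝ} (ht : 0 < t) (htT : t < T) : ∀ᵐ x ∂(volume.restrict Ω), W t x ≤ 0 := by
  have hfin := isFiniteMeasure_restrict hΩb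
  have hT : 0 < T := ht.trans htT
  obtain ⟨M, hM⟩ := exists_bound_deriv_smoothTransition
  have hH := isCutoff_step hM
  have hWi : Integrable (W t) (volume.restrict Ω) :=
    memLp_one_iff_integrable.1 ((Lp.memLp (W t)).mono_exponent (by norm_num))
  have h1 : ∀ n, ∫ x in Ω, primitive (step n) (W t x) ≤ ε n := by
    intro n
    have hc := continuousOn_integral_primitive hΩb hW (hH n)
    have h0 : ∫ x in Ω, primitive (step n) (W 0 x) = 0 := by
      refine integral_eq_zero_of_ae ?_
      filter_upwards [hW0] with x hx using (hH n).primitive_eq_zero hx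
    have hlim : Tendsto (fun s => ∫ x in Ω, primitive (step n) (W s x)) (𝓝[>] 0) (𝓝 0) := by
      have := hc 0 ⟨le_rfl, hT.le⟩
      rw [ContinuousWithinAt, h0] at this
      exact this.mono_left (by
        rw [← nhdsWithin_Ioo_eq_nhdsGT hT]
        exact nhdsWithin_mono _ Set.Ioo_subset_Icc_self)
    -- The energy inequality holds only for s > 0; letting s → 0 removes the initial term, which
    -- tends to 0.
    have h2 := le_of_tendsto ((tendsto_const_nhds
      (x := ∫ x in Ω, primitive (step n) (W t x))).sub hlim) (b := ε n) (by
        rw [← nhdsWithin_Ioo_eq_nhdsGT ht]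
        filter_upwards [self_mem_nhdsWithin] with s hs using hen n s t hs.1 hs.2.le htT)
    simpa using h2
  have hGi : ∀ n, Integrable (fun x => primitive (step n) (W t x)) (volume.restrict Ω) := fun n =>
    hWi.mono ((hH n).lipschitz_primitive.continuous.comp_aestronglyMeasurable hWi.1)
      (Eventually.of_forall fun x => by
        have := (hH n).lipschitz_primitive.dist_le_mul (W t x) 0
        rw [(hH n).primitive_zero] at this
        simpa using this)
  have h3 : ∀ n : ℕ, ∫ x in Ω, max (W t x) 0 ≤
      ε n + 1 / ((n : ℝ) + 1) * (volume.restrict Ω).real Set.univ := by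
    intro n
    have : ∫ x in Ω, max (W t x) 0 ≤
        ∫ x in Ω, (primitive (step n) (W t x) + 1 / ((n : ℝ) + 1)) := by
      refine integral_mono (hWi.sup (integrable_const 0)) ((hGi n).add (integrable_const _)) fun x => ?_
      have h4 := sub_le_primitive_step n (W t x)
      have h5 := (hH n).primitive_nonneg (W t x)
      have h6 : (0 : ℝ) ≤ 1 / ((n : ℝ) + 1) := by positivity
      exact max_le (by linarith) (by linarith)
    rw [integral_add (hGi n) (integrable_const _), integral_const, smul_eq_mul] at this
    linarith [h1 n, mul_comm (1 / ((n : ℝ) + 1)) ((volume.restrict Ω).real Set.univ)]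
  have h4 : ∫ x in Ω, max (W t x) 0 ≤ 0 := by
    have hl := hε.add ((tendsto_one_div_add_atTop_nhds_zero_nat (𝕜 := ℝ)).mul_const
      ((volume.restrict Ω).real Set.univ))
    simp only [zero_mul, add_zero] at hl
    exact ge_of_tendsto' hl h3
  have h5 : 0 ≤ᵐ[volume.restrict Ω] fun x => max (W t x) 0 :=
    Eventually.of_forall fun x => le_max_right _ _
  have h6 := (integral_eq_zero_iff_of_nonneg_ae h5 (hWi.sup (integrable_const 0))).1
    (le_antisymm h4 (integral_nonneg_of_ae h5))
  filter_upwards [h6] with x hx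
  exact max_eq_right_iff.1 hx

/-- The flux term of the energy inequality is bounded using monotonicity and the Lipschitz
condition. -/
theorem neg_sum_flux_le {A : E N → ℝ → ℝ → E N → E N} {L : ℝ} {c : E N × ℝ → ℝ}
    (hmono : MonotoneGrad Ω T A) (hlip : LipschitzInU Ω T p A L c)
    {u v : E N × ℝ → ℝ} {Du Dv : E N × ℝ → E N} {h : E N × ℝ → ℝ} (hh : ∀ z, 0 ≤ h z) :
    ∀ᵐ z ∂(volume.restrict (cyl Ω T)),
      - ∑ j, (A z.1 z.2 (v z) (Dv z) - A z.1 z.2 (u z) (Du z)) j * (h z * (Dv z - Du z) j) ≤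
        ∑ j, L * ((|v z - u z| * h z) *
          ((∑ k, |Du z k| ^ p k + c z) ^ (1 / (p j).conjExponent) * |(Dv z - Du z) j|)) := by
  filter_upwards [hmono, hlip] with z h1 h2
  -- The intermediate flux is A(v, Du): monotonicity handles the change of gradient at fixed v, and
  -- the Lipschitz bound the change from v to u at gradient Du.
  have h3 := mul_nonneg (h1 (v z) (Dv z) (Du z)) (hh z)
  have h4 : ∀ j, -((A z.1 z.2 (v z) (Du z) j - A z.1 z.2 (u z) (Du z) j) * (Dv z j - Du z j)) * h z ≤
      L * ((|v z - u z| * h z) *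
          ((∑ k, |Du z k| ^ p k + c z) ^ (1 / (p j).conjExponent) * |(Dv z - Du z) j|)) := by
    intro j
    have h5 := h2 (v z) (u z) (Du z) j
    rw [Real.conjExponent, one_div_div, add_comm _ (c z)]
    calc _ ≤ |A z.1 z.2 (v z) (Du z) j - A z.1 z.2 (u z) (Du z) j| * |Dv z j - Du z j| * h z := by
          refine mul_le_mul_of_nonneg_right ?_ (hh z)
          rw [← abs_mul]
          exact neg_le_abs _
      _ ≤ (L * |v z - u z| * (c z + ∑ k, |Du z k| ^ p k) ^ ((p j - 1) / p j)) *
          |Dv z j - Du z j| * h z :=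
          mul_le_mul_of_nonneg_right (mul_le_mul_of_nonneg_right h5 (abs_nonneg _)) (hh z)
      _ = _ := by rw [PiLp.sub_apply]; ring
  refine le_trans ?_ (Finset.sum_le_sum fun j _ => h4 j)
  rw [← sub_nonneg, ← Finset.sum_neg_distrib, ← Finset.sum_sub_distrib]
  refine h3.trans (le_of_eq ?_)
  rw [Finset.sum_mul]
  refine Finset.sum_congr rfl fun j _ => ?_
  simp only [PiLp.sub_apply]
  ring

/-- The integrated weak formulation for a weak solution. -/
theorem integral_time_increment_of_weak (hΩ : IsOpen Ω) (hΩb : Bornology.IsBounded Ω)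
    {A : E N → ℝ → ℝ → E N → E N}
    {U : ℝ → Lp ℝ 2 (volume.restrict Ω)} (hU : ContinuousOn U (Set.Icc 0 T))
    {u f : E N × ℝ → ℝ} {Du : E N × ℝ → E N}
    (hUu : ∀ᵐ t ∂(volume.restrict (Set.Ioo 0 T)), ∀ᵐ x ∂(volume.restrict Ω), U t x = u (x, t))
    (hf : Integrable f (volume.restrict (cyl Ω T))) (hDu : IsLpW Ω T p u Du)
    (hflux : ∀ j, Integrable (fun z => A z.1 z.2 (u z) (Du z) j) (volume.restrict (cyl Ω T)))
    (hweak : ∀ φ, IsTest (cyl Ω T) φ →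
      (∫ z in cyl Ω T, ∑ j, A z.1 z.2 (u z) (Du z) j * pdx j φ z)
        - (∫ z in cyl Ω T, u z * pdt φ z) = ∫ z in cyl Ω T, f z * φ z)
    {ψ : E N → ℝ} (hψ : IsTest Ω ψ) {s t : ℝ} (hs : 0 < s) (hst : s ≤ t) (ht : t < T) :
    (∫ x in Ω, U t x * ψ x) - (∫ x in Ω, U s x * ψ x) =
      ∫ z in Ω ×ˢ Set.Ioc s t, (f z * ψ z.1 - ∑ j, A z.1 z.2 (u z) (Du z) j * pd j ψ z.1) :=
  integral_time_increment (B := fun z => A z.1 z.2 (u z) (Du z)) hΩ hΩb hU hUu hDu.integrable hf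
    hflux hweak hψ hs hst ht

end Aniso

/-! ### The comparison principle. -/

theorem theorem3p9 {N : ℕ} {Ω : Set (Aniso.E N)} (hΩ : IsOpen Ω) (hΩb : Bornology.IsBounded Ω)
    {T : ℝ} (hT : 0 < T) {p : Fin N → ℝ} (hp : ∀ j, 1 < p j)
    {A : Aniso.E N → ℝ → ℝ → Aniso.E N → Aniso.E N} (hA : Aniso.IsCaratheodory Ω T A)
    {Λ L : ℝ} (hΛ : 0 < Λ) (hL : 0 < L) {a b c : Aniso.E N × ℝ → ℝ}
    (ha : Integrable a (volume.restrict (Aniso.cyl Ω T)))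
    (hb : Integrable b (volume.restrict (Aniso.cyl Ω T)))
    (hc : Integrable c (volume.restrict (Aniso.cyl Ω T)))
    (ha0 : ∀ᵐ z ∂(volume.restrict (Aniso.cyl Ω T)), 0 ≤ a z)
    (hb0 : ∀ᵐ z ∂(volume.restrict (Aniso.cyl Ω T)), 0 ≤ b z)
    (hc0 : ∀ᵐ z ∂(volume.restrict (Aniso.cyl Ω T)), 0 ≤ c z)
    (hgrowth : Aniso.Growth Ω T p A Λ a) (hcoerc : Aniso.Coercive Ω T p A Λ b)
    (hmono : Aniso.MonotoneGrad Ω T A) (hlip : Aniso.LipschitzInU Ω T p A L c)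
    {u v fu fv gu gv : Aniso.E N × ℝ → ℝ} {u₀ v₀ : Aniso.E N → ℝ}
    (hu₀ : MemLp u₀ 2 (volume.restrict Ω)) (hv₀ : MemLp v₀ 2 (volume.restrict Ω))
    (hfu : MemLp fu 2 (volume.restrict (Aniso.cyl Ω T)))
    (hfv : MemLp fv 2 (volume.restrict (Aniso.cyl Ω T)))
    (hgu : Aniso.MemLpW Ω T p gu) (hgv : Aniso.MemLpW Ω T p gv)
    (hu : Aniso.IsCDSolution Ω T p A fu gu u₀ u)
    (hv : Aniso.IsCDSolution Ω T p A fv gv v₀ v)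
    (h_init : ∀ᵐ x ∂(volume.restrict Ω), v₀ x ≤ u₀ x)
    (h_source : ∀ᵐ z ∂(volume.restrict (Aniso.cyl Ω T)), fv z ≤ fu z)
    (h_bdry : ∀ᵐ z ∂(volume.restrict (Aniso.cyl Ω T)), gv z ≤ gu z) :
    ∀ᵐ z ∂(volume.restrict (Aniso.cyl Ω T)), v z ≤ u z := by
  have hfin := Aniso.isFiniteMeasure_restrict hΩb
  have hfinc : IsFiniteMeasure (volume.restrict (Aniso.cyl Ω T)) := by
    rw [Aniso.restrict_cyl]; infer_instance
  obtain ⟨⟨hu2, Du, hDu, hweaku⟩, ⟨U, hUc, hUu, hU0⟩, ⟨D1, -, -, hbu⟩⟩ := hu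
  obtain ⟨⟨hv2, Dv, hDv, hweakv⟩, ⟨V, hVc, hVv, hV0⟩, ⟨D2, -, -, hbv⟩⟩ := hv
  have hpq := fun j => Real.HolderConjugate.conjExponent (hp j)
  have hq1 : ∀ j, 1 ≤ ENNReal.ofReal (p j).conjExponent := fun j =>
    Aniso.one_le_ofReal (hpq j).symm.lt
  have hfluxu := Aniso.memLp_flux hp hA ha ha0 hgrowth hu2.1.aemeasurable hDu.memLp_grad
  have hfluxv := Aniso.memLp_flux hp hA ha ha0 hgrowth hv2.1.aemeasurable hDv.memLp_grad
  have hfluxui := fun j => memLp_one_iff_integrable.1 ((hfluxu j).mono_exponent (hq1 j))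
  have hfluxvi := fun j => memLp_one_iff_integrable.1 ((hfluxv j).mono_exponent (hq1 j))
  have hfui : Integrable fu (volume.restrict (Aniso.cyl Ω T)) :=
    memLp_one_iff_integrable.1 (hfu.mono_exponent (by norm_num))
  have hfvi : Integrable fv (volume.restrict (Aniso.cyl Ω T)) :=
    memLp_one_iff_integrable.1 (hfv.mono_exponent (by norm_num))
  obtain ⟨M, hM⟩ := Aniso.exists_bound_deriv_smoothTransition
  set W : ℝ → Lp ℝ 2 (volume.restrict Ω) := fun t => V t - U t with hWdef
  have hW : ContinuousOn W (Set.Icc 0 T) := hVc.sub hUc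
  have hWsub : ∀ t, ∀ᵐ x ∂(volume.restrict Ω), W t x = V t x - U t x := fun t =>
    Lp.coeFn_sub (V t) (U t)
  have hWw : ∀ᵐ t ∂(volume.restrict (Set.Ioo 0 T)), ∀ᵐ x ∂(volume.restrict Ω),
      W t x = v (x, t) - u (x, t) := by
    filter_upwards [hUu, hVv] with t h1 h2
    filter_upwards [h1, h2, hWsub t] with x e1 e2 e3
    rw [e3, e1, e2]
  have hid : ∀ ψ, Aniso.IsTest Ω ψ → ∀ s t, 0 < s → s ≤ t → t < T →
      (∫ x in Ω, W t x * ψ x) - (∫ x in Ω, W s x * ψ x) =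
        ∫ z in Ω ×ˢ Set.Ioc s t, ((fv z - fu z) * ψ z.1 -
          ∑ j, (A z.1 z.2 (v z) (Dv z) - A z.1 z.2 (u z) (Du z)) j * Aniso.pd j ψ z.1) := by
    intro ψ hψ s t hs hst ht
    have h1 := Aniso.integral_time_increment_of_weak hΩ hΩb hUc hUu hfui hDu hfluxui hweaku
      hψ hs hst ht
    have h2 := Aniso.integral_time_increment_of_weak hΩ hΩb hVc hVv hfvi hDv hfluxvi hweakv
      hψ hs hst ht
    have hle : (volume : Measure (Aniso.E N × ℝ)).restrict (Ω ×ˢ Set.Ioc s t) ≤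
        volume.restrict (Aniso.cyl Ω T) :=
      Measure.restrict_mono (Aniso.prod_Ioc_subset_cyl hs ht) le_rfl
    have hi : ∀ Z : Lp ℝ 2 (volume.restrict Ω), Integrable (fun x => Z x * ψ x)
        (volume.restrict Ω) := fun Z =>
      memLp_one_iff_integrable.1 (MemLp.mul' (p := 2) (q := 2) hψ.memLp (Lp.memLp Z))
    have h3 : ∀ t, ∫ x in Ω, W t x * ψ x = (∫ x in Ω, V t x * ψ x) - ∫ x in Ω, U t x * ψ x := by
      intro t
      rw [← integral_sub (hi _) (hi _)]
      refine integral_congr_ae ?_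
      filter_upwards [hWsub t] with x hx
      rw [hx, sub_mul]
    rw [h3, h3, sub_sub_sub_comm, h1, h2, ← integral_sub
      (Aniso.integrable_density (B := fun z => A z.1 z.2 (v z) (Dv z)) hfvi hfluxvi hψ
        |>.mono_measure hle)
      (Aniso.integrable_density (B := fun z => A z.1 z.2 (u z) (Du z)) hfui hfluxui hψ
        |>.mono_measure hle)]
    refine integral_congr_ae (Eventually.of_forall fun z => ?_)
    simp only [PiLp.sub_apply, sub_mul, Finset.sum_sub_distrib]
    ring
  have hslice : ∀ᵐ t ∂(volume.restrict (Set.Ioo 0 T)),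
      Aniso.IsW11 Ω (fun x => v (x, t) - u (x, t)) (fun x => Dv (x, t) - Du (x, t)) ∧
        ∃ η Dη, Aniso.IsW1p0 Ω p η Dη ∧
          ∀ᵐ x ∂(volume.restrict Ω), v (x, t) - u (x, t) ≤ η x := by
    filter_upwards [hDu.slice, hDv.slice, hbu, hbv, Aniso.ae_ae_of_ae_cyl h_bdry]
      with t h1 h2 h3 h4 h5
    -- The majorant is η = (v - gv) - (u - gu) = (v - u) + (gu - gv), which is at least v - u by the
    -- order of the boundary data.
    refine ⟨h2.sub h1, _, _, h4.sub hp h3, ?_⟩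
    filter_upwards [h5] with x hx
    linarith
  have hS : Integrable (fun z => ∑ k, |Du z k| ^ p k + c z) (volume.restrict (Aniso.cyl Ω T)) :=
    (Aniso.integrable_sum_rpow hp hDu.memLp_grad).add hc
  have hR : ∀ j, MemLp (fun z => (∑ k, |Du z k| ^ p k + c z) ^ (1 / (p j).conjExponent))
      (ENNReal.ofReal (p j).conjExponent) (volume.restrict (Aniso.cyl Ω T)) := fun j =>
    Aniso.memLp_rpow_inv hS (by
      filter_upwards [hc0] with z hz using add_nonneg (Aniso.sum_rpow_nonneg _) hz) (hpq j).symm.pos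
  have hDw : ∀ j, MemLp (fun z => (Dv z - Du z) j) (ENNReal.ofReal (p j))
      (volume.restrict (Aniso.cyl Ω T)) := fun j => (hDv.memLp_grad j).sub (hDu.memLp_grad j)
  have hRD : ∀ j, Integrable (fun z => (∑ k, |Du z k| ^ p k + c z) ^ (1 / (p j).conjExponent) *
      |(Dv z - Du z) j|) (volume.restrict (Aniso.cyl Ω T)) := fun j =>
    memLp_one_iff_integrable.1
      (MemLp.mul' (hpqr := (hpq j).symm.ennrealOfReal) (hDw j).norm (hR j))
  have hwm : AEStronglyMeasurable (fun z => v z - u z) (volume.restrict (Aniso.cyl Ω T)) :=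
    hv2.1.sub hu2.1
  -- The pointwise bound on the flux term for H_n: |w| H_n'(w) times a fixed integrable function,
  -- summed over j.
  set κ : ℕ → Aniso.E N × ℝ → ℝ := fun n z => ∑ j, L * ((|v z - u z| *
    deriv (Aniso.step n) (v z - u z)) * ((∑ k, |Du z k| ^ p k + c z) ^ (1 / (p j).conjExponent) *
      |(Dv z - Du z) j|)) with hκ
  have hkm : ∀ n, AEStronglyMeasurable
      (fun z => |v z - u z| * deriv (Aniso.step n) (v z - u z)) (volume.restrict (Aniso.cyl Ω T)) :=
    fun n => hwm.norm.mul
      ((Aniso.isCutoff_step hM n).continuous_deriv.comp_aestronglyMeasurable hwm)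
  have hkb : ∀ n z, ‖|v z - u z| * deriv (Aniso.step n) (v z - u z)‖ ≤ M := fun n z => by
    rw [Real.norm_of_nonneg (mul_nonneg (abs_nonneg _) ((Aniso.isCutoff_step hM n).deriv_nonneg _))]
    exact Aniso.abs_mul_deriv_step_le hM n _
  have hκi : ∀ n, Integrable (κ n) (volume.restrict (Aniso.cyl Ω T)) := fun n =>
    integrable_finsetSum _ fun j _ =>
      ((hRD j).bdd_mul (hkm n) (Eventually.of_forall (hkb n))).const_mul L
  have hκ0 : ∀ n, 0 ≤ᵐ[volume.restrict (Aniso.cyl Ω T)] κ n := fun n => by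
    filter_upwards [hc0] with z hz
    refine Finset.sum_nonneg fun j _ => mul_nonneg hL.le (mul_nonneg (mul_nonneg (abs_nonneg _)
      ((Aniso.isCutoff_step hM n).deriv_nonneg _)) (mul_nonneg (Real.rpow_nonneg
        (add_nonneg (Aniso.sum_rpow_nonneg _) hz) _) (abs_nonneg _)))
  have hκlim : Tendsto (fun n => ∫ z in Aniso.cyl Ω T, κ n z) atTop (𝓝 0) := by
    have h := tendsto_integral_of_dominated_convergence (μ := volume.restrict (Aniso.cyl Ω T))
      (F := κ) (f := fun _ => 0)
      (fun z => ∑ j, L * (M * ‖(∑ k, |Du z k| ^ p k + c z) ^ (1 / (p j).conjExponent) *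
        |(Dv z - Du z) j|‖)) (fun n => (hκi n).1)
      (integrable_finsetSum _ fun j _ => ((hRD j).norm.const_mul M).const_mul L) ?_ ?_
    · simpa using h
    · refine fun n => Eventually.of_forall fun z => (norm_sum_le _ _).trans ?_
      refine Finset.sum_le_sum fun j _ => ?_
      rw [norm_mul, Real.norm_of_nonneg hL.le, norm_mul]
      exact mul_le_mul_of_nonneg_left (mul_le_mul_of_nonneg_right (hkb n z) (abs_nonneg _)) hL.le
    · refine Eventually.of_forall fun z => ?_
      have h2 : Tendsto (fun n => κ n z) atTop (𝓝 (∑ j : Fin N, L * (0 *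
          ((∑ k, |Du z k| ^ p k + c z) ^ (1 / (p j).conjExponent) * |(Dv z - Du z) j|)))) :=
        tendsto_finsetSum _ fun j _ =>
          ((Aniso.tendsto_abs_mul_deriv_step (v z - u z)).mul_const _).const_mul L
      simpa using h2
  have hen : ∀ n s t, 0 < s → s ≤ t → t < T →
      (∫ x in Ω, Aniso.primitive (Aniso.step n) (W t x)) -
        (∫ x in Ω, Aniso.primitive (Aniso.step n) (W s x)) ≤ ∫ z in Aniso.cyl Ω T, κ n z := by
    intro n s t hs hst ht
    have hH := Aniso.isCutoff_step hM n
    have hsub := Aniso.prod_Ioc_subset_cyl (Ω := Ω) hs ht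
    have hle : (volume : Measure (Aniso.E N × ℝ)).restrict (Ω ×ˢ Set.Ioc s t) ≤
        volume.restrict (Aniso.cyl Ω T) := Measure.restrict_mono hsub le_rfl
    have hB : ∀ j, MemLp (fun z => (A z.1 z.2 (v z) (Dv z) - A z.1 z.2 (u z) (Du z)) j)
        (ENNReal.ofReal (p j).conjExponent) (volume.restrict (Aniso.cyl Ω T)) := fun j =>
      (hfluxv j).sub (hfluxu j)
    have h1 := Aniso.energy_le (w := fun z => v z - u z) (F := fun z => fv z - fu z)
      (B := fun z => A z.1 z.2 (v z) (Dv z) - A z.1 z.2 (u z) (Du z)) (Dw := fun z => Dv z - Du z)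
      hΩ hΩb hpq hW hWw hwm (hfv.sub hfu)
      (by filter_upwards [h_source] with z hz using sub_nonpos.2 hz) hB hDw hslice hid hH hs hst ht
    have hζ : ∀ j, MemLp (fun z => deriv (Aniso.step n) (v z - u z) * (Dv z - Du z) j)
        (ENNReal.ofReal (p j)) (volume.restrict (Aniso.cyl Ω T)) := fun j =>
      (hDw j).of_le_mul (c := ((n : ℝ) + 1) * M)
        ((hH.continuous_deriv.comp_aestronglyMeasurable hwm).mul (hDw j).1)
        (Eventually.of_forall fun x => by
          rw [norm_mul]
          exact mul_le_mul_of_nonneg_right (hH.deriv_le _) (norm_nonneg _))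
    have hi : ∀ j, Integrable (fun z => (A z.1 z.2 (v z) (Dv z) - A z.1 z.2 (u z) (Du z)) j *
        (deriv (Aniso.step n) (v z - u z) * (Dv z - Du z) j))
        (volume.restrict (Ω ×ˢ Set.Ioc s t)) := fun j =>
      (memLp_one_iff_integrable.1
        (MemLp.mul' (hpqr := (hpq j).symm.ennrealOfReal) (hζ j) (hB j))).mono_measure hle
    refine h1.trans ?_
    rw [← integral_finsetSum _ fun j _ => hi j, ← integral_neg]
    calc _ ≤ ∫ z in Ω ×ˢ Set.Ioc s t, κ n z :=
          integral_mono_ae (integrable_finsetSum _ fun j _ => hi j).neg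
            ((hκi n).mono_measure hle) (ae_mono hle (Aniso.neg_sum_flux_le hmono hlip
              (h := fun z => deriv (Aniso.step n) (v z - u z)) fun z => hH.deriv_nonneg _))
      -- Since κ ≥ 0, integrating over the whole cylinder gives an error independent of s and t.
      _ ≤ _ := integral_mono_measure hle (hκ0 n) (hκi n)
  have hW0 : ∀ᵐ x ∂(volume.restrict Ω), W 0 x ≤ 0 := by
    filter_upwards [hWsub 0, Aniso.ae_eq_initial hT hUc hu₀ hU0, Aniso.ae_eq_initial hT hVc hv₀ hV0,
      h_init] with x e1 e2 e3 e4
    rw [e1, e2, e3]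
    exact sub_nonpos.2 e4
  have hmain : ∀ᵐ t ∂(volume.restrict (Set.Ioo 0 T)), ∀ᵐ x ∂(volume.restrict Ω),
      v (x, t) - u (x, t) ≤ 0 := by
    filter_upwards [hWw, ae_restrict_mem measurableSet_Ioo] with t h1 h2
    filter_upwards [h1, Aniso.ae_nonpos_of_energy hΩb hW hW0 hκlim hen h2.1 h2.2] with x e1 e2
    rwa [← e1]
  -- Returning from almost every slice to almost every point needs a measurable set, hence the
  -- measurable representative of v - u.
  have hmk := Aniso.ae_ae_of_ae_cyl hwm.ae_eq_mk
  have hfinal : ∀ᵐ z ∂(volume.restrict (Aniso.cyl Ω T)), hwm.mk _ z ≤ 0 := by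
    refine Aniso.ae_cyl_of_ae_ae
      (measurableSet_le hwm.stronglyMeasurable_mk.measurable measurable_const) ?_
    filter_upwards [hmain, hmk] with t h1 h2
    filter_upwards [h1, h2] with x e1 e2
    rwa [← e2]
  filter_upwards [hfinal, hwm.ae_eq_mk] with z h1 h2
  rw [← h2] at h1
  exact sub_nonpos.1 h1
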